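/- Let $\mathbb{T}^2=(\mathbb{R}/2\pi\mathbb{Z})^2$ and $\langle\cdot\rangle=(1+|\cdot|^2)^{1/2}$. For a complex-valued function $u(t,x)$ on $\mathbb{R}\times\mathbb{T}^2$ let $$\tilde u(\sigma,k)=\int_{\mathbb{R}\times\mathbb{T}^2}u(t,x)\,e^{-i\sigma t-i\langle k,x\rangle}\,dx\,dt,\qquad \sigma\in\mathbb{R},\ k\in\mathbb{Z}^2,$$ be its space-time Fourier transform (in the sense of tempered distributions in $t$), and for $s,b\in\mathbb{R}$ let $X^{s,b}=X^{s,b}(\mathbb{R}\times\mathbb{T}^2)$ be the space of functions $u$ for which $\tilde u$ is a function and $$\|u\|_{X^{s,b}}=\big\|\langle k\rangle^s\langle\sigma+|k|^2\rangle^b\,\tilde u(\sigma,k)\big\|_{L^2_\sigma l^2_k}<\infty .$$ **Lemma.** Let $s>0$ and $b>\max\left(\frac14,\frac12-\frac s4\right)$. There is a constant $C$, depending only on $s$ and $b$, such that for every permutation $\sigma$ of $\{1,2,3\}$ and all functions $u_1,u_2,u_3$ with $u_{\sigma(1)},u_{\sigma(2)}\in X^{s,b}$ and $u_{\sigma(3)}\in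 X^{0,b}$, the product $u_1\overline{u_2}u_3$ belongs to $X^{0,-b}$ and $$\|u_1\overline{u_2}u_3\|_{X^{0,-b}}\le C\,\|u_{\sigma(1)}\|_{X^{s,b}}\|u_{\sigma(2)}\|_{X^{s,b}}\|u_{\sigma(3)}\|_{X^{0,b}}.$$ -/

import Mathlib

open MeasureTheory

noncomputable section

instance fact_zero_lt_two_pi : Fact (0 < 2 * Real.pi) := ⟨Real.two_pi_pos⟩

/-- The two-dimensional torus `𝕋² = (ℝ / 2πℤ)²`. Its `volume` is the product of the Lebesgue
measures of the two circles, of total mass `4π²`. -/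
abbrev Torus2 : Type := Fin 2 → AddCircle (2 * Real.pi)

/-- The character `x ↦ e^{-i⟨k,x⟩}` of `𝕋²`, for `k ∈ ℤ²`. (On `AddCircle T`, `fourier n` is
`x ↦ e^{2πinx/T}`, which for `T = 2π` is `e^{inx}`.) -/
def torusChar (k : Fin 2 → ℤ) (x : Torus2) : ℂ :=
  ∏ j, fourier (-(k j)) (x j)

/-- `|k|² = k₁² + k₂²` for `k ∈ ℤ²`. -/
def freqSq (k : Fin 2 → ℤ) : ℝ := ∑ j, (k j : ℝ) ^ 2

/-- `∫ ψ(σ) e^{-iσt} dσ`. -/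
def timeFourier (ψ : SchwartzMap ℝ ℂ) (t : ℝ) : ℂ :=
  ∫ σ : ℝ, ψ σ * Complex.exp (-Complex.I * σ * t)

/-- The function `U(σ,k)` on `ℝ × ℤ²` is the space-time Fourier transform
`∫_{ℝ × 𝕋²} u(t,x) e^{-iσt - i⟨k,x⟩} dx dt` of the function `u(t,x)` on `ℝ × 𝕋²`, in the sense of
tempered distributions in time: tested against a Schwartz function `ψ(σ)`, the transform is moved
onto `ψ`. Both `u` and every `U(·,k)` are required to be integrable against Schwartz functions of
time, respectively of `σ`, so that no integral below takes a default value. -/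
structure IsSpaceTimeFourier (u : ℝ × Torus2 → ℂ) (U : ℝ → (Fin 2 → ℤ) → ℂ) : Prop where
  integrable_left : ∀ ψ : SchwartzMap ℝ ℂ, Integrable (fun p : ℝ × Torus2 => ψ p.1 * u p)
  integrable_right : ∀ (k : Fin 2 → ℤ) (ψ : SchwartzMap ℝ ℂ), Integrable (fun σ : ℝ => ψ σ * U σ k)
  integral_eq : ∀ (k : Fin 2 → ℤ) (ψ : SchwartzMap ℝ ℂ),
    ∫ p : ℝ × Torus2, timeFourier ψ p.1 * (u p * torusChar k p.2) = ∫ σ : ℝ, ψ σ * U σ k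

/-- The weight `⟨k⟩^s ⟨σ + |k|²⟩^b`, where `⟨·⟩ = (1 + |·|²)^{1/2}`. -/
def bourgainWeight (s b : ℝ) (σ : ℝ) (k : Fin 2 → ℤ) : ℝ :=
  √(1 + freqSq k) ^ s * √(1 + (σ + freqSq k) ^ 2) ^ b

/-- The norm `‖⟨k⟩^s ⟨σ + |k|²⟩^b U(σ,k)‖_{L² l²}` in `[0, ∞]`. -/
def weightedL2Norm (s b : ℝ) (U : ℝ → (Fin 2 → ℤ) → ℂ) : ENNReal :=
  (∑' k : Fin 2 → ℤ, ∫⁻ σ : ℝ,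
    (ENNReal.ofReal (bourgainWeight s b σ k) * ‖U σ k‖ₑ) ^ 2) ^ (1 / 2 : ℝ)

/-- The Bourgain norm `‖u‖_{X^{s,b}} ∈ [0, ∞]` of a function `u` on `ℝ × 𝕋²`. The space-time Fourier
transform is unique up to null sets, so the infimum runs over representatives of one and the
same function; it is `∞` if the Fourier transform of `u` is not a function. -/
def bourgainNorm (s b : ℝ) (u : ℝ × Torus2 → ℂ) : ENNReal :=
  ⨅ (U : ℝ → (Fin 2 → ℤ) → ℂ) (_ : IsSpaceTimeFourier u U), weightedL2Norm s b U

/-- The Bourgain space `X^{s,b}(ℝ × 𝕋²)`: the functions with finite `X^{s,b}` norm. -/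
def BourgainSpace (s b : ℝ) : Set (ℝ × Torus2 → ℂ) :=
  {u | bourgainNorm s b u < ⊤}

end

/-! The estimate follows by duality from the bilinear bound `‖u v‖_{L²} ≲ ‖u‖_{X^{s,b}}
‖v‖_{X^{0,b}}`. Pair the product with a test function `g` of `X^{0,b}`, group the four factors into
two pairs, each containing one of the two factors from `X^{s,b}`, and apply Cauchy–Schwarz. Only
moduli in physical space enter, so the complex conjugate and the permutation play no role.

By Plancherel and a weighted Cauchy–Schwarz inequality, the bilinear bound reduces to bounding `∑_k
∫ ⟨k⟩^{-2s} ⟨σ+|k|²⟩^{-2b} ⟨τ-σ+|m-k|²⟩^{-2b} dσ` uniformly in `(τ, m)`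
(`exists_bilinear_kernel_le`). By monotonicity in `b` one may take `b < 1/2`. The integral in `σ` is
then `O(⟨τ+|k|²+|m-k|²⟩^{-a})` for every `0 ≤ a < 4b - 1`, and the hypothesis on `b` says exactly
that some such `a` has `s + a > 1`.

Since `|k|² + |m-k|² = (|m|² + |2k-m|²)/2`, the sum over `k` is sorted by the circles `|2k-m|² = n`.
Such a circle has `O(N^ε)` lattice points of size at most `N`, uniformly in `m` and `n`: three of
them are not collinear and force `n = O(N⁶)`, after which the divisor bound in `ℤ[i]` applies. Hence
`⟨k⟩^{-δ}` has a bounded sum over every circle (`exists_tsum_circle_rpow_le`), and the remaining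
decay sums over `n` (`exists_tsum_resonance_le`).

The rest is the passage to general functions. The transform is defined by testing, so `u` is first
identified with an `L²` limit of trigonometric sums (`IsSpaceTimeFourier.isWaveLimit`). Fatou's
lemma carries the bilinear bound over. The product turns out to be integrable, so its transform is
an honest integral, to which `weightedEnergy_spaceTimeFourierIntegral_le` applies. -/

/-! ### The divisor bound in the Gaussian integers -/

section DivisorBound

/-- The classical proof of `d(n) = O(n^ε)`: if `f a ≥ 2^{1/ε}`, then `e + 1 ≤ 2^e ≤ (f a)^{εe}`
without loss. Only finitely many `a` are smaller, and each of them costs at most a fixed factor `K`.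
-/
theorem exists_prod_count_add_one_le {α : Type*} [DecidableEq α] (f : α → ℝ)
    (hf : ∀ r : ℝ, {a | f a < r}.Finite) {ε : ℝ} (hε : 0 < ε) :
    ∃ C : ℝ, 0 < C ∧ ∀ s : Multiset α, (∀ a ∈ s, 2 ≤ f a) →
      ((∏ a ∈ s.toFinset, (s.count a + 1) : ℕ) : ℝ) ≤ C * ((s.map f).prod) ^ ε := by
  obtain ⟨K, hK1, hK⟩ : ∃ K : ℝ, 1 ≤ K ∧ ∀ e : ℕ, (e : ℝ) + 1 ≤ K * ((2 : ℝ) ^ ε) ^ e := by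
    have h2 : 0 < (2 : ℝ) ^ ε - 1 := by
      have := Real.one_lt_rpow (x := 2) (by norm_num) hε
      linarith
    refine ⟨1 + 1 / ((2 : ℝ) ^ ε - 1), by have := one_div_pos.2 h2; linarith, fun e => ?_⟩
    have hb := one_add_mul_le_pow (a := (2 : ℝ) ^ ε - 1) (by linarith) e
    rw [add_sub_cancel] at hb
    have h1 : 1 ≤ ((2 : ℝ) ^ ε) ^ e := one_le_pow₀ (by linarith)
    have : (e : ℝ) ≤ 1 / ((2 : ℝ) ^ ε - 1) * ((2 : ℝ) ^ ε) ^ e := by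
      rw [div_mul_eq_mul_div, le_div_iff₀ h2]; linarith
    linarith
  set B : Finset α := (hf ((2 : ℝ) ^ (1 / ε))).toFinset with hB
  refine ⟨K ^ B.card, by positivity, fun s hs => ?_⟩
  have hprod : ((s.map f).prod) ^ ε = ∏ a ∈ s.toFinset, ((f a) ^ ε) ^ s.count a := by
    rw [Finset.prod_multiset_map_count, ← Real.finsetProd_rpow]
    · refine Finset.prod_congr rfl fun a ha => ?_
      have := hs a (Multiset.mem_toFinset.1 ha)
      rw [← Real.rpow_natCast, ← Real.rpow_mul (by linarith), mul_comm, Real.rpow_mul (by linarith),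
        Real.rpow_natCast]
    · intro a ha
      have := hs a (Multiset.mem_toFinset.1 ha)
      positivity
  have hc : ∏ a ∈ s.toFinset, (if a ∈ B then K else 1) ≤ K ^ B.card := by
    rw [Finset.prod_ite, Finset.prod_const_one, mul_one, Finset.prod_const]
    refine pow_le_pow_right₀ hK1 (Finset.card_le_card ?_)
    intro a ha
    exact (Finset.mem_filter.1 ha).2
  rw [hprod]
  push_cast
  calc ∏ a ∈ s.toFinset, ((s.count a : ℝ) + 1)
      ≤ ∏ a ∈ s.toFinset, ((if a ∈ B then K else 1) * ((f a) ^ ε) ^ s.count a) := by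
        refine Finset.prod_le_prod (fun a _ => by positivity) fun a ha => ?_
        have h2 := hs a (Multiset.mem_toFinset.1 ha)
        split_ifs with h
        · refine (hK _).trans ?_
          gcongr
        · have h3 : (2 : ℝ) ≤ (f a) ^ ε := by
            have : (2 : ℝ) ^ (1 / ε) ≤ f a := by simpa [hB] using h
            calc (2 : ℝ) = ((2 : ℝ) ^ (1 / ε)) ^ ε := by
                  rw [← Real.rpow_mul (by norm_num), one_div_mul_cancel hε.ne', Real.rpow_one]
              _ ≤ _ := by gcongr
          rw [one_mul]
          have := Nat.lt_two_pow_self (n := s.count a)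
          calc (s.count a : ℝ) + 1 ≤ 2 ^ s.count a := by exact_mod_cast this
            _ ≤ _ := by gcongr
    _ = (∏ a ∈ s.toFinset, (if a ∈ B then K else 1)) * ∏ a ∈ s.toFinset, ((f a) ^ ε) ^ s.count a :=
        Finset.prod_mul_distrib
    _ ≤ _ := by
        refine mul_le_mul_of_nonneg_right hc (Finset.prod_nonneg fun a ha => ?_)
        have h2 := hs a (Multiset.mem_toFinset.1 ha)
        positivity

theorem GaussianInt.finite_norm_lt (r : ℝ) : {z : GaussianInt | ((z.norm : ℤ) : ℝ) < r}.Finite := by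
  have hfin : ((Set.Icc (-⌈r⌉) ⌈r⌉) ×ˢ (Set.Icc (-⌈r⌉) ⌈r⌉)).Finite :=
    (Set.finite_Icc _ _).prod (Set.finite_Icc _ _)
  refine Set.Finite.subset (hfin.image fun p : ℤ × ℤ => (⟨p.1, p.2⟩ : GaussianInt)) fun z hz => ?_
  have h : z.norm ≤ ⌈r⌉ := by
    have h1 : ((z.norm : ℤ) : ℝ) < ⌈r⌉ := lt_of_lt_of_le hz (Int.le_ceil r)
    exact_mod_cast h1.le
  rw [Zsqrtd.norm_def] at h
  refine ⟨(z.re, z.im), ?_, rfl⟩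
  simp only [Set.mem_prod, Set.mem_Icc]
  refine ⟨⟨?_, ?_⟩, ?_, ?_⟩ <;> nlinarith [sq_nonneg z.re, sq_nonneg z.im, sq_nonneg (z.re - 1),
    sq_nonneg (z.re + 1), sq_nonneg (z.im - 1), sq_nonneg (z.im + 1), Int.le_self_sq z.re, Int.le_self_sq z.im,
    Int.le_self_sq (-z.re), Int.le_self_sq (-z.im)]

theorem GaussianInt.two_le_norm_of_prime {p : GaussianInt} (hp : Prime p) : 2 ≤ p.norm := by
  have h0 : 0 < p.norm := GaussianInt.norm_pos.2 hp.ne_zero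
  have h1 : p.norm ≠ 1 := by
    intro h
    exact hp.not_isUnit ((Zsqrtd.norm_eq_one_iff' (by norm_num) p).1 h)
  omega

/-- The number of Gaussian integers of norm `n` is `O(n^ε)`. -/
theorem GaussianInt.exists_card_norm_eq_le {ε : ℝ} (hε : 0 < ε) :
    ∃ C : ℝ, 0 < C ∧ ∀ (n : ℕ) (T : Finset GaussianInt), n ≠ 0 → (∀ z ∈ T, z.norm = n) →
      (T.card : ℝ) ≤ C * (n : ℝ) ^ ε := by
  classical
  let _ : StrongNormalizationMonoid GaussianInt :=
    UniqueFactorizationMonoid.strongNormalizationMonoid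
  -- The exponent is halved because the prime factors of `n` in `ℤ[i]` have norms with product `n²`.
  obtain ⟨C, hC0, hC⟩ := exists_prod_count_add_one_le (fun z : GaussianInt => ((z.norm : ℤ) : ℝ))
    GaussianInt.finite_norm_lt (half_pos hε)
  -- `V` contains all units, so its cardinality bounds the size of each class of associates.
  set V : Finset GaussianInt := (GaussianInt.finite_norm_lt 2).toFinset with hV
  refine ⟨(V.card + 1) * C, by positivity, fun n T hn hT => ?_⟩
  have hn' : (n : GaussianInt) ≠ 0 := by exact_mod_cast hn
  have hne : ∀ z ∈ T, z ≠ 0 := by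
    rintro z hz rfl
    have := hT _ hz
    simp at this
    exact hn (by exact_mod_cast this.symm)
  set F := UniqueFactorizationMonoid.normalizedFactors (n : GaussianInt) with hF
  -- An element of norm `n` divides `n`, the cofactor being its conjugate; up to units it is
  -- therefore a submultiset of the prime factors of `n`.
  have hmaps : ∀ z ∈ T, UniqueFactorizationMonoid.normalizedFactors z ∈ Finset.Iic F := by
    intro z hz
    rw [Finset.mem_Iic, hF,
      ← UniqueFactorizationMonoid.dvd_iff_normalizedFactors_le_normalizedFactors (hne z hz) hn']
    refine ⟨star z, ?_⟩
    have := Zsqrtd.norm_eq_mul_conj z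
    rw [hT z hz] at this
    exact_mod_cast this
  have hcard : T.card ≤ V.card * (Finset.Iic F).card := by
    refine Finset.card_le_mul_card_image_of_maps_to hmaps V.card fun m _ => ?_
    rcases Finset.eq_empty_or_nonempty
      (T.filter fun z => UniqueFactorizationMonoid.normalizedFactors z = m) with h | ⟨z₀, hz₀⟩
    · rw [h]; simp
    · refine (Finset.card_le_card (t := V.image fun u => z₀ * u) fun z hz => ?_).trans
        Finset.card_image_le
      rw [Finset.mem_filter] at hz hz₀
      have has : Associated z₀ z := by
        rw [UniqueFactorizationMonoid.associated_iff_normalizedFactors_eq_normalizedFactors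
          (hne _ hz₀.1) (hne _ hz.1), hz₀.2, hz.2]
      obtain ⟨u, hu⟩ := has
      refine Finset.mem_image.2 ⟨u, ?_, hu⟩
      have : (u : GaussianInt).norm = 1 := (Zsqrtd.norm_eq_one_iff' (by norm_num) _).2 u.isUnit
      refine (Set.Finite.mem_toFinset _).2 ?_
      rw [Set.mem_ofPred_eq, this]
      norm_num
  rw [Multiset.card_Iic] at hcard
  have h2 := hC F fun a ha => by
    have := GaussianInt.two_le_norm_of_prime
      (UniqueFactorizationMonoid.prime_of_normalized_factor a ha)
    exact_mod_cast this
  have hnorm : (F.map fun z : GaussianInt => ((z.norm : ℤ) : ℝ)).prod = (n : ℝ) ^ (2 : ℝ) := by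
    have h1 : (F.map fun z : GaussianInt => (z.norm : ℤ)).prod = F.prod.norm :=
      (map_multiset_prod (Zsqrtd.normMonoidHom (d := -1)) F).symm
    have h3 : F.prod.norm = (n : GaussianInt).norm :=
      Zsqrtd.norm_eq_of_associated (by norm_num)
        (UniqueFactorizationMonoid.prod_normalizedFactors hn')
    have h4 : (F.map fun z : GaussianInt => ((z.norm : ℤ) : ℝ)).prod
        = (((F.map fun z : GaussianInt => (z.norm : ℤ)).prod : ℤ) : ℝ) := by
      rw [Int.cast_multiset_prod, Multiset.map_map]; rfl
    rw [h4, h1, h3, Zsqrtd.norm_natCast]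
    push_cast
    rw [Real.rpow_two, sq]
  rw [hnorm, ← Real.rpow_mul (by positivity), mul_div_cancel₀ _ (two_ne_zero)] at h2
  calc (T.card : ℝ) ≤ V.card * ((∏ a ∈ F.toFinset, (F.count a + 1) : ℕ) : ℝ) := by exact_mod_cast hcard
    _ ≤ V.card * (C * (n : ℝ) ^ ε) := by gcongr
    _ ≤ (V.card + 1) * C * (n : ℝ) ^ ε := by
      have : 0 ≤ C * (n : ℝ) ^ ε := by positivity
      nlinarith

end DivisorBound

/-! ### Lattice points on circles -/

section CirclePoints

/-- Three distinct lattice points on a circle are not collinear. -/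
theorem cross_ne_zero_of_mem_circle {x y a b c d : ℤ} (h1 : x * a + y * b = -(a ^ 2 + b ^ 2))
    (h2 : x * c + y * d = -(c ^ 2 + d ^ 2)) (hab : a ≠ 0 ∨ b ≠ 0) (hcd : c ≠ 0 ∨ d ≠ 0)
    (hne : c ≠ a ∨ d ≠ b) : a * d - b * c ≠ 0 := by
  intro h
  -- If the two chords were parallel, `(c, d) = λ(a, b)`, the equations would give `λ² = λ`. The two
  -- identities express this coordinatewise, without division.
  have key1 : c * (c - a) * (a ^ 2 + b ^ 2) = 0 := by
    linear_combination (-a * c) * h1 + a ^ 2 * h2 + (-y * a - a * d - b * c) * h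
  have key2 : d * (d - b) * (a ^ 2 + b ^ 2) = 0 := by
    linear_combination (-b * d) * h1 + b ^ 2 * h2 + (x * b + a * d + b * c) * h
  have hpos : a ^ 2 + b ^ 2 ≠ 0 := by
    rcases hab with h | h
    · have := sq_nonneg b; positivity
    · have := sq_nonneg a; positivity
  have k1 := (mul_eq_zero.1 key1).resolve_right hpos
  have k2 := (mul_eq_zero.1 key2).resolve_right hpos
  rcases mul_eq_zero.1 k1 with hc | hc <;> rcases mul_eq_zero.1 k2 with hd | hd
  · rcases hcd with h' | h' <;> contradiction
  · have hd : d = b := by linarith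
    subst hc; subst hd
    have : a * d = 0 := by linarith
    rcases mul_eq_zero.1 this with h' | h'
    · subst h'; simp at hne
    · subst h'; simp at hcd
  · have hc : c = a := by linarith
    subst hd; subst hc
    have : b * c = 0 := by linarith
    rcases mul_eq_zero.1 this with h' | h'
    · subst h'; simp at hne
    · subst h'; simp at hcd
  · rcases hne with h' | h'
    · exact h' (by linarith)
    · exact h' (by linarith)

/-- Cramer's rule: `x` times the determinant is a cubic expression in the chords, and a nonzero
integer determinant has modulus at least 1. -/
theorem abs_le_of_cross_ne_zero {x y a b c d : ℤ} {N : ℝ} (hN : 0 ≤ N)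
    (h1 : x * a + y * b = -(a ^ 2 + b ^ 2))
    (h2 : x * c + y * d = -(c ^ 2 + d ^ 2)) (h : a * d - b * c ≠ 0) (ha : |(a : ℝ)| ≤ 2 * N)
    (hb : |(b : ℝ)| ≤ 2 * N) (hc : |(c : ℝ)| ≤ 2 * N) (hd : |(d : ℝ)| ≤ 2 * N) :
    |(x : ℝ)| ≤ 32 * N ^ 3 := by
  have e : x * (a * d - b * c) = -((a ^ 2 + b ^ 2) * d) + (c ^ 2 + d ^ 2) * b := by
    linear_combination d * h1 - b * h2
  have e' : (x : ℝ) * ((a * d - b * c : ℤ) : ℝ)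
      = -(((a : ℝ) ^ 2 + b ^ 2) * d) + ((c : ℝ) ^ 2 + d ^ 2) * b := by exact_mod_cast e
  have hD : (1 : ℝ) ≤ |((a * d - b * c : ℤ) : ℝ)| := by exact_mod_cast Int.one_le_abs h
  have sqb : ∀ {t : ℝ}, |t| ≤ 2 * N → t ^ 2 ≤ 4 * N ^ 2 := fun {t} ht => by
    have := pow_le_pow_left₀ (abs_nonneg t) ht 2
    rw [sq_abs] at this; linarith
  calc |(x : ℝ)| ≤ |(x : ℝ)| * |((a * d - b * c : ℤ) : ℝ)| := le_mul_of_one_le_right (abs_nonneg _) hD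
    _ = |-(((a : ℝ) ^ 2 + b ^ 2) * d) + ((c : ℝ) ^ 2 + d ^ 2) * b| := by rw [← abs_mul, e']
    _ ≤ |-(((a : ℝ) ^ 2 + b ^ 2) * d)| + |((c : ℝ) ^ 2 + d ^ 2) * b| := abs_add_le _ _
    _ = ((a : ℝ) ^ 2 + b ^ 2) * |(d : ℝ)| + ((c : ℝ) ^ 2 + d ^ 2) * |(b : ℝ)| := by
        rw [abs_neg, abs_mul, abs_mul, abs_of_nonneg (a := (a : ℝ) ^ 2 + b ^ 2) (by positivity),
          abs_of_nonneg (a := (c : ℝ) ^ 2 + d ^ 2) (by positivity)]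
    _ ≤ (4 * N ^ 2 + 4 * N ^ 2) * (2 * N) + (4 * N ^ 2 + 4 * N ^ 2) * (2 * N) := by
        gcongr <;> first | assumption | exact sqb (by assumption)
    _ = 32 * N ^ 3 := by ring

/-- `|2k - m|²` for lattice points `k`, `m`. -/
def circleIndex (m k : Fin 2 → ℤ) : ℤ := (2 * k 0 - m 0) ^ 2 + (2 * k 1 - m 1) ^ 2

theorem freqSq_eq (k : Fin 2 → ℤ) : freqSq k = (k 0 : ℝ) ^ 2 + (k 1 : ℝ) ^ 2 := by
  simp [freqSq, Fin.sum_univ_two]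

theorem freqSq_nonneg (k : Fin 2 → ℤ) : 0 ≤ freqSq k := by
  rw [freqSq_eq]; positivity

theorem abs_apply_le_sqrt_freqSq (k : Fin 2 → ℤ) (i : Fin 2) : |(k i : ℝ)| ≤ √(1 + freqSq k) := by
  refine Real.abs_le_sqrt ?_
  rw [freqSq_eq]
  fin_cases i <;> simp <;> nlinarith [sq_nonneg (k 0 : ℝ), sq_nonneg (k 1 : ℝ)]

theorem one_le_sqrt_freqSq (k : Fin 2 → ℤ) : 1 ≤ √(1 + freqSq k) :=
  Real.one_le_sqrt.2 (by linarith [freqSq_nonneg k])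

/-- Three lattice points of size at most `N` on a circle bound its radius by `O(N³)`. -/
theorem circleIndex_le_of_two_lt_card {m : Fin 2 → ℤ} {n : ℤ} {N : ℝ} {T : Finset (Fin 2 → ℤ)}
    (hT : ∀ k ∈ T, circleIndex m k = n ∧ √(1 + freqSq k) ≤ N) (hcard : 2 < T.card) :
    (n : ℝ) ≤ 2048 * N ^ 6 := by
  obtain ⟨p, q, r, hp, hq, hr, hpq, hpr, hqr⟩ := Finset.two_lt_card_iff.1 hcard
  have hN : 0 ≤ N := (Real.sqrt_nonneg _).trans (hT p hp).2
  have hco : ∀ k ∈ T, ∀ i, |(k i : ℝ)| ≤ N := fun k hk i =>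
    (abs_apply_le_sqrt_freqSq k i).trans (hT k hk).2
  have hdiff : ∀ k ∈ T, ∀ i, |((k i - p i : ℤ) : ℝ)| ≤ 2 * N := fun k hk i => by
    push_cast
    refine (abs_sub _ _).trans ?_
    linarith [hco k hk i, hco p hp i]
  -- Subtracting the circle equations at `k` and `p` leaves a linear equation for `2p - m`, twice
  -- the vector from the centre `m/2` to `p`.
  have heq : ∀ k ∈ T, (2 * p 0 - m 0) * (k 0 - p 0) + (2 * p 1 - m 1) * (k 1 - p 1)
      = -((k 0 - p 0) ^ 2 + (k 1 - p 1) ^ 2) := fun k hk => by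
    have h := (hT k hk).1.trans (hT p hp).1.symm
    simp only [circleIndex] at h
    linarith
  have hne : ∀ {k l : Fin 2 → ℤ}, k ≠ l → k 0 ≠ l 0 ∨ k 1 ≠ l 1 := fun {k l} h => by
    by_contra! hc
    exact h (funext fun i => by fin_cases i <;> simp [hc.1, hc.2])
  have hcr := cross_ne_zero_of_mem_circle (heq q hq) (heq r hr)
    ((hne hpq.symm).imp sub_ne_zero.2 sub_ne_zero.2) ((hne hpr.symm).imp sub_ne_zero.2 sub_ne_zero.2)
    ((hne hqr.symm).imp (fun h h' => h (by linarith)) (fun h h' => h (by linarith)))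
  have hx := abs_le_of_cross_ne_zero hN (heq q hq) (heq r hr) hcr (hdiff q hq 0) (hdiff q hq 1)
    (hdiff r hr 0) (hdiff r hr 1)
  -- Exchanging the coordinates changes the sign of the determinant and bounds the other component;
  -- then `2 · (32N³)² = 2048N⁶`.
  have hy := abs_le_of_cross_ne_zero (x := 2 * p 1 - m 1) (y := 2 * p 0 - m 0) hN
    (by linarith [heq q hq]) (by linarith [heq r hr])
    (fun h => hcr (by linear_combination -h)) (hdiff q hq 1) (hdiff q hq 0) (hdiff r hr 1) (hdiff r hr 0)
  have hn : (n : ℝ) = ((2 * p 0 - m 0 : ℤ) : ℝ) ^ 2 + ((2 * p 1 - m 1 : ℤ) : ℝ) ^ 2 := by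
    rw [← (hT p hp).1]; simp [circleIndex]
  rw [hn, ← sq_abs, ← sq_abs ((2 * p 1 - m 1 : ℤ) : ℝ)]
  have h1 := pow_le_pow_left₀ (abs_nonneg _) hx 2
  have h2 := pow_le_pow_left₀ (abs_nonneg _) hy 2
  nlinarith

/-- Either there are at most two points, or the squared radius is `O(N⁶)` and the divisor bound with
exponent `ε/6` applies to `2k - m` as a Gaussian integer. This is what makes the bound independent
of `m` and `n`. -/
theorem exists_card_circle_le {ε : ℝ} (hε : 0 < ε) :
    ∃ C : ℝ, 0 < C ∧ ∀ (m : Fin 2 → ℤ) (n : ℤ) (N : ℝ) (T : Finset (Fin 2 → ℤ)), 1 ≤ N →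
      (∀ k ∈ T, circleIndex m k = n ∧ √(1 + freqSq k) ≤ N) → (T.card : ℝ) ≤ C * N ^ ε := by
  obtain ⟨C, hC0, hC⟩ := GaussianInt.exists_card_norm_eq_le (ε := ε / 6) (by positivity)
  refine ⟨2 + C * 2048 ^ (ε / 6), by positivity, fun m n N T hN hT => ?_⟩
  have hNε : 1 ≤ N ^ ε := Real.one_le_rpow hN hε.le
  have hpos : 0 ≤ C * (2048 : ℝ) ^ (ε / 6) * N ^ ε := by positivity
  rcases le_or_gt T.card 2 with h | h
  · have : (T.card : ℝ) ≤ 2 := by exact_mod_cast h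
    nlinarith
  have hn := circleIndex_le_of_two_lt_card hT h
  have hinj : Function.Injective
      (fun k : Fin 2 → ℤ => (⟨2 * k 0 - m 0, 2 * k 1 - m 1⟩ : GaussianInt)) := by
    intro k l hkl
    simp only [Zsqrtd.mk.injEq] at hkl
    funext i
    fin_cases i <;> simp <;> omega
  have hnorm : ∀ k ∈ T, (⟨2 * k 0 - m 0, 2 * k 1 - m 1⟩ : GaussianInt).norm = n := fun k hk => by
    rw [← (hT k hk).1, Zsqrtd.norm_def, circleIndex]; ring
  obtain ⟨k₀, hk₀⟩ : T.Nonempty := Finset.card_pos.1 (by omega)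
  have hn0 : 0 ≤ n := by rw [← hnorm k₀ hk₀]; exact GaussianInt.norm_nonneg _
  lift n to ℕ using hn0
  have hnz : n ≠ 0 := by
    rintro rfl
    obtain ⟨p, q, hp, hq, hpq⟩ := Finset.one_lt_card_iff.1 (by omega : 1 < T.card)
    refine hpq (hinj ?_)
    have h1 := GaussianInt.norm_eq_zero.1 (hnorm p hp)
    have h2 := GaussianInt.norm_eq_zero.1 (hnorm q hq)
    exact h1.trans h2.symm
  have := hC n (T.image _) hnz (fun z hz => by
    obtain ⟨k, hk, rfl⟩ := Finset.mem_image.1 hz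
    exact hnorm k hk)
  rw [Finset.card_image_of_injective _ hinj] at this
  calc (T.card : ℝ) ≤ C * (n : ℝ) ^ (ε / 6) := this
    _ ≤ C * (2048 * N ^ 6) ^ (ε / 6) := by gcongr; exact_mod_cast hn
    _ = C * 2048 ^ (ε / 6) * N ^ ε := by
      rw [Real.mul_rpow (by positivity) (by positivity), ← Real.rpow_natCast N 6,
        ← Real.rpow_mul (by linarith)]
      norm_num
      rw [mul_div_cancel₀ _ (by norm_num)]; ring
    _ ≤ _ := by nlinarith

open scoped ENNReal

/-- Layer cake bound of a sum over a set of polynomially bounded counting function. -/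
theorem exists_tsum_circle_rpow_le {δ : ℝ} (hδ : 0 < δ) :
    ∃ C : ℝ≥0∞, C ≠ ∞ ∧ ∀ (m : Fin 2 → ℤ) (n : ℤ),
      ∑' k : Fin 2 → ℤ, (if circleIndex m k = n then ENNReal.ofReal (√(1 + freqSq k) ^ (-δ)) else 0)
        ≤ C := by
  classical
  -- Counting with exponent `δ/2` leaves the factor `2^{-jδ/2}` on the `j`-th dyadic scale, hence a
  -- geometric series.
  obtain ⟨C, hC0, hC⟩ := exists_card_circle_le (half_pos hδ)
  have hq1 : (2 : ℝ) ^ (-(δ / 2)) < 1 := Real.rpow_lt_one_of_one_lt_of_neg (by norm_num) (by linarith)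
  have hq0 : 0 < (2 : ℝ) ^ (-(δ / 2)) := by positivity
  refine ⟨∑' j : ℕ, ENNReal.ofReal (2 ^ δ * C * ((2 : ℝ) ^ (-(δ / 2))) ^ j), ?_, fun m n => ?_⟩
  · rw [← ENNReal.ofReal_tsum_of_nonneg (fun j => by positivity)
      ((summable_geometric_of_lt_one hq0.le hq1).mul_left _)]
    exact ENNReal.ofReal_ne_top
  have hpt : ∀ k : Fin 2 → ℤ, ENNReal.ofReal (√(1 + freqSq k) ^ (-δ)) ≤
      ∑' j : ℕ, (if √(1 + freqSq k) ≤ 2 ^ j then ENNReal.ofReal (2 ^ δ * (2 ^ j : ℝ) ^ (-δ)) else 0) := by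
    intro k
    have h1 := one_le_sqrt_freqSq k
    obtain ⟨j, hj1, hj2⟩ := exists_nat_pow_near h1 (one_lt_two)
    refine le_trans ?_ (ENNReal.le_tsum (j + 1))
    rw [if_pos hj2.le]
    refine ENNReal.ofReal_le_ofReal ?_
    calc √(1 + freqSq k) ^ (-δ) ≤ (2 ^ j : ℝ) ^ (-δ) :=
          Real.rpow_le_rpow_of_nonpos (by positivity) hj1 (by linarith)
      _ = 2 ^ δ * (2 ^ (j + 1) : ℝ) ^ (-δ) := by
          rw [pow_succ, Real.mul_rpow (by positivity) (by norm_num), mul_left_comm,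
            ← Real.rpow_add (by norm_num), add_neg_cancel, Real.rpow_zero, mul_one]
  calc ∑' k : Fin 2 → ℤ, (if circleIndex m k = n then ENNReal.ofReal (√(1 + freqSq k) ^ (-δ)) else 0)
      ≤ ∑' k : Fin 2 → ℤ, ∑' j : ℕ, (if circleIndex m k = n ∧ √(1 + freqSq k) ≤ 2 ^ j then
          ENNReal.ofReal (2 ^ δ * (2 ^ j : ℝ) ^ (-δ)) else 0) := by
        refine ENNReal.tsum_le_tsum fun k => ?_
        split_ifs with h
        · simpa [h] using hpt k
        · simp
    _ = ∑' j : ℕ, ∑' k : Fin 2 → ℤ, (if circleIndex m k = n ∧ √(1 + freqSq k) ≤ 2 ^ j then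
          ENNReal.ofReal (2 ^ δ * (2 ^ j : ℝ) ^ (-δ)) else 0) := ENNReal.tsum_comm
    _ ≤ _ := by
        refine ENNReal.tsum_le_tsum fun j => ?_
        rw [ENNReal.tsum_eq_iSup_sum]
        refine iSup_le fun T => ?_
        rw [← Finset.sum_filter, Finset.sum_const, nsmul_eq_mul]
        have hT := hC m n (2 ^ j) (T.filter fun k => circleIndex m k = n ∧ √(1 + freqSq k) ≤ 2 ^ j)
          (one_le_pow₀ (by norm_num)) (fun k hk => (Finset.mem_filter.1 hk).2)
        rw [← ENNReal.ofReal_natCast, ← ENNReal.ofReal_mul (by positivity)]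
        refine ENNReal.ofReal_le_ofReal ?_
        calc _ ≤ C * (2 ^ j : ℝ) ^ (δ / 2) * (2 ^ δ * (2 ^ j : ℝ) ^ (-δ)) := by gcongr
          _ = 2 ^ δ * C * ((2 ^ j : ℝ) ^ (δ / 2) * (2 ^ j : ℝ) ^ (-δ)) := by ring
          _ = 2 ^ δ * C * ((2 : ℝ) ^ (-(δ / 2))) ^ j := by
            rw [← Real.rpow_add (by positivity), ← Real.rpow_natCast 2 j, ← Real.rpow_natCast,
              ← Real.rpow_mul (by norm_num), ← Real.rpow_mul (by norm_num)]
            congr 2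
            ring

end CirclePoints

/-! ### The uniform bound for the bilinear kernel -/

section KernelBound

open scoped ENNReal

theorem one_le_sqrt_one_add_sq (x : ℝ) : 1 ≤ √(1 + x ^ 2) :=
  Real.one_le_sqrt.2 (by linarith [sq_nonneg x])

theorem lintegral_sqrt_one_add_sq_rpow_lt_top {p : ℝ} (hp : 1 < p) :
    ∫⁻ x : ℝ, ENNReal.ofReal (√(1 + x ^ 2) ^ (-p)) < ∞ := by
  have h := integrable_rpow_neg_one_add_norm_sq (E := ℝ) (μ := volume) (r := p) (by simpa using hp)
  refine lt_of_eq_of_lt (lintegral_congr fun x => ?_) h.lintegral_lt_top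
  rw [Real.sqrt_eq_rpow, ← Real.rpow_mul (by positivity), Real.norm_eq_abs, sq_abs]
  congr 2; ring

theorem sqrt_one_add_add_sq_le (x y : ℝ) :
    √(1 + (x + y) ^ 2) ≤ 2 * max √(1 + x ^ 2) √(1 + y ^ 2) := by
  refine (Real.sqrt_le_left (by positivity)).2 ?_
  have hx := Real.sq_sqrt (show 0 ≤ 1 + x ^ 2 by positivity)
  have hy := Real.sq_sqrt (show 0 ≤ 1 + y ^ 2 by positivity)
  have h1 := pow_le_pow_left₀ (Real.sqrt_nonneg _) (le_max_left √(1 + x ^ 2) √(1 + y ^ 2)) 2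
  have h2 := pow_le_pow_left₀ (Real.sqrt_nonneg _) (le_max_right √(1 + x ^ 2) √(1 + y ^ 2)) 2
  nlinarith [sq_nonneg (x - y)]

/-- The larger bracket `Y` spends `a` of its powers on `Z`; its other `q - a` powers are passed to
the smaller bracket `X`. -/
theorem rpow_mul_rpow_le_of_le {q a X Y Z : ℝ} (ha : 0 ≤ a) (haq : a ≤ q) (hX : 0 < X) (hZ : 0 < Z)
    (hXY : X ≤ Y) (h : Z ≤ 2 * Y) :
    X ^ (-q) * Y ^ (-q) ≤ 2 ^ a * Z ^ (-a) * X ^ (-(2 * q - a)) := by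
  have hY : 0 < Y := hX.trans_le hXY
  have h1 : Y ^ (-a) ≤ 2 ^ a * Z ^ (-a) := by
    have : (2 * Y) ^ (-a) ≤ Z ^ (-a) := Real.rpow_le_rpow_of_nonpos hZ h (by linarith)
    rw [Real.mul_rpow (by norm_num) hY.le] at this
    calc Y ^ (-a) = 2 ^ a * (2 ^ (-a) * Y ^ (-a)) := by
          rw [← mul_assoc, ← Real.rpow_add (by norm_num), add_neg_cancel, Real.rpow_zero, one_mul]
      _ ≤ _ := by gcongr
  calc X ^ (-q) * Y ^ (-q) = X ^ (-q) * Y ^ (-(q - a)) * Y ^ (-a) := by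
        rw [mul_assoc, ← Real.rpow_add hY]; congr 2; ring
    _ ≤ X ^ (-q) * X ^ (-(q - a)) * (2 ^ a * Z ^ (-a)) := by
        gcongr ?_ * ?_ * ?_
        exact Real.rpow_le_rpow_of_nonpos hX hXY (by linarith)
    _ = _ := by rw [← Real.rpow_add hX, mul_comm]; congr 2; ring

/-- The arguments `σ + α` and `β - σ` add up to `α + β`, so the larger bracket is at least
`⟨α+β⟩/2`. What remains is a power `-(2q - a)` of one bracket, integrable since `2q - a > 1`. -/
theorem exists_lintegral_modulation_le {q a : ℝ} (ha : 0 ≤ a) (haq : a ≤ q) (h : 1 < 2 * q - a) :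
    ∃ C : ℝ≥0∞, C ≠ ∞ ∧ ∀ α β : ℝ,
      ∫⁻ σ : ℝ, ENNReal.ofReal (√(1 + (σ + α) ^ 2) ^ (-q) * √(1 + (β - σ) ^ 2) ^ (-q))
        ≤ C * ENNReal.ofReal (√(1 + (α + β) ^ 2) ^ (-a)) := by
  set I := ∫⁻ x : ℝ, ENNReal.ofReal (√(1 + x ^ 2) ^ (-(2 * q - a))) with hI
  have hIfin : I < ∞ := lintegral_sqrt_one_add_sq_rpow_lt_top h
  refine ⟨ENNReal.ofReal (2 ^ a) * (I + I), ?_, fun α β => ?_⟩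
  · exact ENNReal.mul_ne_top ENNReal.ofReal_ne_top (ENNReal.add_ne_top.2 ⟨hIfin.ne, hIfin.ne⟩)
  set Z := √(1 + (α + β) ^ 2) with hZ
  have hZ0 : 0 < Z := by positivity
  have hpt : ∀ σ : ℝ, ENNReal.ofReal (√(1 + (σ + α) ^ 2) ^ (-q) * √(1 + (β - σ) ^ 2) ^ (-q)) ≤
      ENNReal.ofReal (2 ^ a * Z ^ (-a)) * (ENNReal.ofReal (√(1 + (σ + α) ^ 2) ^ (-(2 * q - a))) +
        ENNReal.ofReal (√(1 + (β - σ) ^ 2) ^ (-(2 * q - a)))) := by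
    intro σ
    have hle := sqrt_one_add_add_sq_le (σ + α) (β - σ)
    rw [show σ + α + (β - σ) = α + β by ring, ← hZ] at hle
    rw [mul_add, ← ENNReal.ofReal_mul (by positivity), ← ENNReal.ofReal_mul (by positivity)]
    rcases le_total √(1 + (σ + α) ^ 2) √(1 + (β - σ) ^ 2) with h' | h'
    · rw [max_eq_right h'] at hle
      exact (ENNReal.ofReal_le_ofReal
        (rpow_mul_rpow_le_of_le ha haq (by positivity) hZ0 h' hle)).trans le_self_add
    · rw [max_eq_left h'] at hle
      rw [mul_comm (√(1 + (σ + α) ^ 2) ^ (-q))]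
      exact (ENNReal.ofReal_le_ofReal
        (rpow_mul_rpow_le_of_le ha haq (by positivity) hZ0 h' hle)).trans le_add_self
  refine (lintegral_mono hpt).trans ?_
  rw [lintegral_const_mul' _ _ ENNReal.ofReal_ne_top, lintegral_add_left (by fun_prop),
    lintegral_add_right_eq_self (fun x => ENNReal.ofReal (√(1 + x ^ 2) ^ (-(2 * q - a)))) α,
    lintegral_sub_left_eq_self (fun x => ENNReal.ofReal (√(1 + x ^ 2) ^ (-(2 * q - a)))) β,
    ENNReal.ofReal_mul (by positivity)]
  rw [mul_right_comm]

theorem tsum_sqrt_freqSq_rpow_ne_top {r : ℝ} (hr : 2 < r) :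
    ∑' k : Fin 2 → ℤ, ENNReal.ofReal (√(1 + freqSq k) ^ (-r)) ≠ ∞ := by
  have hsum : Summable fun k : Fin 2 → ℤ => √(1 + freqSq k) ^ (-r) := by
    refine Summable.of_norm_bounded_eventually (EisensteinSeries.summable_one_div_norm_rpow hr) ?_
    have : ∀ᶠ k : Fin 2 → ℤ in Filter.cofinite, k ≠ 0 :=
      (Set.finite_singleton 0).compl_mem_cofinite
    filter_upwards [this] with k hk
    rw [Real.norm_of_nonneg (by positivity)]
    refine Real.rpow_le_rpow_of_nonpos (norm_pos_iff.2 hk) ?_ (by linarith)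
    refine (pi_norm_le_iff_of_nonneg (by positivity)).2 fun i => ?_
    exact (abs_apply_le_sqrt_freqSq k i)
  rw [← ENNReal.ofReal_tsum_of_nonneg (fun k => by positivity) hsum]
  exact ENNReal.ofReal_ne_top

/-- Uniformity in `c` comes from translating the index by `⌊2c⌋`: `c + n/2` differs from `(n +
⌊2c⌋)/2` by less than `1/2`. -/
theorem exists_tsum_int_shift_le {A : ℝ} (hA : 1 < A) :
    ∃ C : ℝ≥0∞, C ≠ ∞ ∧ ∀ c : ℝ,
      ∑' n : ℤ, ENNReal.ofReal (√(1 + (c + n / 2) ^ 2) ^ (-A)) ≤ C := by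
  have hsum : Summable fun l : ℤ => 4 ^ A * √(1 + (l : ℝ) ^ 2) ^ (-A) := by
    refine Summable.mul_left _ ?_
    refine Summable.of_norm_bounded_eventually (Real.summable_abs_int_rpow hA) ?_
    have : ∀ᶠ l : ℤ in Filter.cofinite, l ≠ 0 :=
      (Set.finite_singleton (0 : ℤ)).compl_mem_cofinite
    filter_upwards [this] with l hl
    rw [Real.norm_of_nonneg (by positivity)]
    exact Real.rpow_le_rpow_of_nonpos (by positivity) (Real.abs_le_sqrt (by linarith)) (by linarith)
  refine ⟨∑' l : ℤ, ENNReal.ofReal (4 ^ A * √(1 + (l : ℝ) ^ 2) ^ (-A)), ?_, fun c => ?_⟩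
  · rw [← ENNReal.ofReal_tsum_of_nonneg (fun k => by positivity) hsum]
    exact ENNReal.ofReal_ne_top
  rw [← (Equiv.addRight ⌊2 * c⌋).tsum_eq (fun l : ℤ => ENNReal.ofReal (4 ^ A * √(1 + (l : ℝ) ^ 2) ^ (-A)))]
  refine ENNReal.tsum_le_tsum fun n => ENNReal.ofReal_le_ofReal ?_
  simp only [Equiv.coe_addRight, Int.cast_add]
  set j : ℝ := (⌊2 * c⌋ : ℝ)
  have h1 : j ≤ 2 * c := Int.floor_le _
  have h2 : 2 * c < j + 1 := Int.lt_floor_add_one _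
  have h3 : √(1 + (n + j) ^ 2) ≤ 4 * √(1 + (c + n / 2) ^ 2) := by
    refine (Real.sqrt_le_left (by positivity)).2 ?_
    rw [mul_pow, Real.sq_sqrt (by positivity)]
    have h4 : (2 * c - j) ^ 2 ≤ 1 := by nlinarith
    nlinarith [sq_nonneg (n + 2 * c + (2 * c - j)), sq_nonneg (n + 2 * c)]
  calc √(1 + (c + n / 2) ^ 2) ^ (-A) = 4 ^ A * (4 * √(1 + (c + n / 2) ^ 2)) ^ (-A) := by
        rw [Real.mul_rpow (by norm_num) (by positivity), ← mul_assoc, ← Real.rpow_add (by norm_num),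
          add_neg_cancel, Real.rpow_zero, one_mul]
    _ ≤ _ := by
        gcongr ?_ * ?_
        exact Real.rpow_le_rpow_of_nonpos (by positivity) h3 (by linarith)

/-- The parallelogram law: for fixed `m`, the resonance function depends on `k` only through the
circle containing it. -/
theorem freqSq_add_freqSq_sub (m k : Fin 2 → ℤ) :
    freqSq k + freqSq (m - k) = freqSq m / 2 + (circleIndex m k : ℝ) / 2 := by
  simp only [freqSq_eq, circleIndex, Pi.sub_apply]
  push_cast; ring

/-- Here `X = ⟨k⟩` and `Y` is the resonance bracket. If `X² ≤ Y`, the decay in `Y` becomes decay in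
`X`, to be summed over all of `ℤ²`. Otherwise all but `δ` powers of `X` become decay in `Y`, to be
summed over the circles. -/
theorem rpow_mul_rpow_le_add {s a δ X Y : ℝ} (ha : 0 ≤ a) (hδ : δ / 2 ≤ s) (hX : 1 ≤ X) (hY : 1 ≤ Y) :
    X ^ (-(2 * s)) * Y ^ (-a) ≤ X ^ (-(2 * (s + a))) + X ^ (-δ) * Y ^ (-(s - δ / 2 + a)) := by
  have hX0 : 0 < X := by linarith
  have hY0 : 0 < Y := by linarith
  rcases le_total (X ^ 2) Y with h | h
  · have h1 : Y ^ (-a) ≤ (X ^ 2) ^ (-a) := Real.rpow_le_rpow_of_nonpos (by positivity) h (by linarith)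
    have h2 : X ^ (-(2 * s)) * (X ^ 2) ^ (-a) = X ^ (-(2 * (s + a))) := by
      rw [← Real.rpow_natCast, ← Real.rpow_mul hX0.le, ← Real.rpow_add hX0]
      congr 1; push_cast; ring
    calc _ ≤ X ^ (-(2 * s)) * (X ^ 2) ^ (-a) := by gcongr
      _ = X ^ (-(2 * (s + a))) := h2
      _ ≤ _ := le_add_of_nonneg_right (by positivity)
  · have h1 : (X ^ 2) ^ (-(s - δ / 2)) ≤ Y ^ (-(s - δ / 2)) :=
      Real.rpow_le_rpow_of_nonpos (by positivity) h (by linarith)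
    calc X ^ (-(2 * s)) * Y ^ (-a) = X ^ (-δ) * (X ^ 2) ^ (-(s - δ / 2)) * Y ^ (-a) := by
          rw [← Real.rpow_natCast X 2, ← Real.rpow_mul hX0.le, ← Real.rpow_add hX0]
          congr 2; push_cast; ring
      _ ≤ X ^ (-δ) * Y ^ (-(s - δ / 2)) * Y ^ (-a) := by gcongr
      _ = X ^ (-δ) * Y ^ (-(s - δ / 2 + a)) := by
          rw [mul_assoc, ← Real.rpow_add hY0]; congr 2; ring
      _ ≤ _ := le_add_of_nonneg_left (by positivity)

theorem exists_tsum_resonance_le {s a : ℝ} (hs : 0 < s) (ha : 0 ≤ a) (hsa : 1 < s + a) :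
    ∃ C : ℝ≥0∞, C ≠ ∞ ∧ ∀ (m : Fin 2 → ℤ) (c : ℝ),
      ∑' k : Fin 2 → ℤ, ENNReal.ofReal (√(1 + freqSq k) ^ (-(2 * s)) *
        √(1 + (c + (freqSq k + freqSq (m - k))) ^ 2) ^ (-a)) ≤ C := by
  -- The bound `δ ≤ s` permits the exchange of powers, and `δ ≤ s + a - 1` keeps `s - δ/2 + a > 1`.
  set δ := min s (s + a - 1) with hδ
  have hδ0 : 0 < δ := lt_min hs (by linarith)
  have hδs : δ ≤ s := min_le_left _ _
  have hδa : δ ≤ s + a - 1 := min_le_right _ _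
  obtain ⟨C₁, hC₁, h₁⟩ := exists_tsum_circle_rpow_le hδ0
  obtain ⟨C₂, hC₂, h₂⟩ := exists_tsum_int_shift_le (A := s - δ / 2 + a) (by linarith)
  refine ⟨∑' k : Fin 2 → ℤ, ENNReal.ofReal (√(1 + freqSq k) ^ (-(2 * (s + a)))) + C₂ * C₁,
    ENNReal.add_ne_top.2 ⟨tsum_sqrt_freqSq_rpow_ne_top (by linarith), ENNReal.mul_ne_top hC₂ hC₁⟩,
    fun m c => ?_⟩
  have hY : ∀ k, c + (freqSq k + freqSq (m - k)) = (c + freqSq m / 2) + (circleIndex m k : ℝ) / 2 := by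
    intro k; rw [freqSq_add_freqSq_sub]; ring
  simp only [hY]
  set Y : ℤ → ℝ := fun n => √(1 + ((c + freqSq m / 2) + (n : ℝ) / 2) ^ 2) with hYdef
  have hY1 : ∀ n, 1 ≤ Y n := fun n => one_le_sqrt_one_add_sq _
  calc ∑' k : Fin 2 → ℤ, ENNReal.ofReal (√(1 + freqSq k) ^ (-(2 * s)) * Y (circleIndex m k) ^ (-a))
      ≤ ∑' k : Fin 2 → ℤ, (ENNReal.ofReal (√(1 + freqSq k) ^ (-(2 * (s + a)))) +
          ENNReal.ofReal (√(1 + freqSq k) ^ (-δ)) *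
            ENNReal.ofReal (Y (circleIndex m k) ^ (-(s - δ / 2 + a)))) := by
        refine ENNReal.tsum_le_tsum fun k => ?_
        rw [← ENNReal.ofReal_mul (by positivity),
          ← ENNReal.ofReal_add (by positivity) (by have := hY1 (circleIndex m k); positivity)]
        exact ENNReal.ofReal_le_ofReal
          (rpow_mul_rpow_le_add ha (by linarith) (one_le_sqrt_freqSq k) (hY1 _))
    _ = ∑' k : Fin 2 → ℤ, ENNReal.ofReal (√(1 + freqSq k) ^ (-(2 * (s + a)))) +
        ∑' k : Fin 2 → ℤ, ENNReal.ofReal (√(1 + freqSq k) ^ (-δ)) *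
            ENNReal.ofReal (Y (circleIndex m k) ^ (-(s - δ / 2 + a))) := ENNReal.tsum_add
    _ ≤ _ := by
        gcongr
        -- Each `k` lies on exactly one circle, so a sum over `n` may be inserted and exchanged with
        -- the sum over `k`.
        calc _ = ∑' k : Fin 2 → ℤ, ∑' n : ℤ, ENNReal.ofReal (Y n ^ (-(s - δ / 2 + a))) *
              (if circleIndex m k = n then ENNReal.ofReal (√(1 + freqSq k) ^ (-δ)) else 0) := by
              refine tsum_congr fun k => ?_
              rw [tsum_eq_single (circleIndex m k) (fun n hn => by rw [if_neg hn.symm, mul_zero]),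
                if_pos rfl, mul_comm]
          _ = ∑' n : ℤ, ENNReal.ofReal (Y n ^ (-(s - δ / 2 + a))) * ∑' k : Fin 2 → ℤ,
              (if circleIndex m k = n then ENNReal.ofReal (√(1 + freqSq k) ^ (-δ)) else 0) := by
              rw [ENNReal.tsum_comm]
              simp only [ENNReal.tsum_mul_left]
          _ ≤ ∑' n : ℤ, ENNReal.ofReal (Y n ^ (-(s - δ / 2 + a))) * C₁ := by
              gcongr with n; exact h₁ m n
          _ = (∑' n : ℤ, ENNReal.ofReal (Y n ^ (-(s - δ / 2 + a)))) * C₁ := ENNReal.tsum_mul_right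
          _ ≤ C₂ * C₁ := by gcongr; exact h₂ _

theorem exists_bilinear_kernel_le {s b : ℝ} (hs : 0 < s) (hb : 1 / 4 < b) (hb' : b < 1 / 2)
    (hsb : 1 / 2 - s / 4 < b) :
    ∃ C : ℝ≥0∞, C ≠ ∞ ∧ ∀ (τ : ℝ) (m : Fin 2 → ℤ),
      ∑' k : Fin 2 → ℤ, ∫⁻ σ : ℝ, ENNReal.ofReal (bourgainWeight (-(2 * s)) (-(2 * b)) σ k *
        bourgainWeight 0 (-(2 * b)) (τ - σ) (m - k)) ≤ C := by
  -- The two lower bounds on `b` say that `4b - 1` exceeds `0` and `1 - s`. The later condition `a ≤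
  -- 2b` follows from `4b - 1 < 2b`, that is, from `b < 1/2`.
  obtain ⟨a, ha1, ha2⟩ : ∃ a, max 0 (1 - s) < a ∧ a < 4 * b - 1 :=
    exists_between (max_lt (by linarith) (by linarith))
  have ha0 : 0 < a := lt_of_le_of_lt (le_max_left _ _) ha1
  have has : 1 - s < a := lt_of_le_of_lt (le_max_right _ _) ha1
  obtain ⟨C₁, hC₁, h₁⟩ := exists_lintegral_modulation_le (q := 2 * b) ha0.le (by linarith)
    (by linarith)
  obtain ⟨C₂, hC₂, h₂⟩ := exists_tsum_resonance_le hs ha0.le (by linarith : 1 < s + a)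
  refine ⟨C₁ * C₂, ENNReal.mul_ne_top hC₁ hC₂, fun τ m => ?_⟩
  calc ∑' k : Fin 2 → ℤ, ∫⁻ σ : ℝ, ENNReal.ofReal (bourgainWeight (-(2 * s)) (-(2 * b)) σ k *
        bourgainWeight 0 (-(2 * b)) (τ - σ) (m - k))
      ≤ ∑' k : Fin 2 → ℤ, C₁ * ENNReal.ofReal (√(1 + freqSq k) ^ (-(2 * s)) *
          √(1 + (τ + (freqSq k + freqSq (m - k))) ^ 2) ^ (-a)) := by
        refine ENNReal.tsum_le_tsum fun k => ?_
        have := h₁ (freqSq k) (τ + freqSq (m - k))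
        calc _ = ENNReal.ofReal (√(1 + freqSq k) ^ (-(2 * s))) * ∫⁻ σ : ℝ, ENNReal.ofReal
              (√(1 + (σ + freqSq k) ^ 2) ^ (-(2 * b)) *
                √(1 + (τ + freqSq (m - k) - σ) ^ 2) ^ (-(2 * b))) := by
              rw [← lintegral_const_mul' _ _ ENNReal.ofReal_ne_top]
              refine lintegral_congr fun σ => ?_
              rw [← ENNReal.ofReal_mul (by positivity), bourgainWeight, bourgainWeight,
                Real.rpow_zero, one_mul, mul_assoc, show τ - σ + freqSq (m - k)
                  = τ + freqSq (m - k) - σ by ring]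
          _ ≤ ENNReal.ofReal (√(1 + freqSq k) ^ (-(2 * s))) *
              (C₁ * ENNReal.ofReal (√(1 + (freqSq k + (τ + freqSq (m - k))) ^ 2) ^ (-a))) := by
              gcongr
          _ = _ := by
              rw [mul_left_comm, ← ENNReal.ofReal_mul (by positivity),
                show freqSq k + (τ + freqSq (m - k)) = τ + (freqSq k + freqSq (m - k)) by ring]
    _ ≤ C₁ * C₂ := by rw [ENNReal.tsum_mul_left]; gcongr; exact h₂ m τ

end KernelBound

/-! ### The Fourier transform in time -/

section TimeFourier

open scoped ENNReal FourierTransform SchwartzMap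

/-- `∫ f(σ) e^{iσt} dσ`. -/
noncomputable def timeWave (f : ℝ → ℂ) (t : ℝ) : ℂ :=
  ∫ σ : ℝ, f σ * Complex.exp (Complex.I * σ * t)

theorem timeWave_eq_fourier (f : ℝ → ℂ) (t : ℝ) : timeWave f t = 𝓕 f (-(2 * Real.pi)⁻¹ * t) := by
  rw [Real.fourier_eq', timeWave]
  congr 1
  funext σ
  rw [smul_eq_mul, mul_comm]
  congr 2
  have : (Real.pi : ℂ) ≠ 0 := by exact_mod_cast Real.pi_ne_zero
  simp
  field_simp

theorem timeFourier_eq_fourier (ψ : 𝓢(ℝ, ℂ)) (t : ℝ) :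
    timeFourier ψ t = 𝓕 ψ ((2 * Real.pi)⁻¹ * t) := by
  rw [SchwartzMap.fourier_coe, Real.fourier_eq', timeFourier]
  congr 1
  funext σ
  rw [smul_eq_mul, mul_comm]
  congr 2
  have : (Real.pi : ℂ) ≠ 0 := by exact_mod_cast Real.pi_ne_zero
  simp
  field_simp

theorem continuous_fourier_of_integrable {f : ℝ → ℂ} (hf : Integrable f) : Continuous (𝓕 f) :=
  VectorFourier.fourierIntegral_continuous Real.continuous_fourierChar continuous_inner hf

theorem continuous_timeWave {f : ℝ → ℂ} (hf : Integrable f) : Continuous (timeWave f) := by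
  have h := (continuous_fourier_of_integrable hf).comp (continuous_const_mul (-(2 * Real.pi)⁻¹))
  exact h.congr fun t => (timeWave_eq_fourier f t).symm

theorem norm_timeWave_le (f : ℝ → ℂ) (t : ℝ) : ‖timeWave f t‖ ≤ ∫ σ, ‖f σ‖ := by
  rw [timeWave_eq_fourier]
  exact VectorFourier.norm_fourierIntegral_le_integral_norm _ _ _ _ _

theorem ae_eq_of_integral_schwartz_mul_eq {f g : ℝ → ℂ} (hf : LocallyIntegrable f)
    (hg : LocallyIntegrable g) (h : ∀ ψ : 𝓢(ℝ, ℂ), ∫ x, ψ x * f x = ∫ x, ψ x * g x) :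
    f =ᵐ[volume] g := by
  refine ae_eq_of_integral_contDiff_smul_eq hf hg fun φ hφ hc => ?_
  have hc' : HasCompactSupport fun x => (φ x : ℂ) := hc.comp_left Complex.ofReal_zero
  have := h (hc'.toSchwartzMap (Complex.ofRealCLM.contDiff.comp hφ))
  simp only [Complex.real_smul]
  exact this

/-- The Fourier integral and the abstract `L²` transform have the same pairings with Schwartz
functions, so they agree almost everywhere and the isometry property carries over. -/
theorem lintegral_norm_fourier_sq {f : ℝ → ℂ} (hf : Integrable f) (hf2 : MemLp f 2) :
    ∫⁻ x, ‖𝓕 f x‖ₑ ^ 2 = ∫⁻ x, ‖f x‖ₑ ^ 2 := by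
  set L : Lp (α := ℝ) ℂ 2 volume := hf2.toLp f with hL
  have hae : (𝓕 L : Lp (α := ℝ) ℂ 2 volume) =ᵐ[volume] 𝓕 f := by
    refine ae_eq_of_integral_schwartz_mul_eq
      ((Lp.memLp _).locallyIntegrable one_le_two)
      (continuous_fourier_of_integrable hf).locallyIntegrable fun ψ => ?_
    have h1 : Lp.toTemperedDistribution (𝓕 L : Lp (α := ℝ) ℂ 2 volume) ψ
        = Lp.toTemperedDistribution L (𝓕 ψ) := by
      rw [← Lp.fourier_toTemperedDistribution_eq, TemperedDistribution.fourier_apply]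
    simp only [Lp.toTemperedDistribution_apply, smul_eq_mul] at h1
    rw [h1]
    have h2 : ∫ x, 𝓕 ψ x * L x = ∫ x, 𝓕 ψ x * f x := by
      refine integral_congr_ae ?_
      filter_upwards [hf2.coeFn_toLp] with x hx
      rw [hL, hx]
    rw [h2]
    have := VectorFourier.integral_bilin_fourierIntegral_eq_flip (ContinuousLinearMap.mul ℂ ℂ)
      (L := innerₗ ℝ) Real.continuous_fourierChar continuous_inner
      (SchwartzMap.integrable (μ := volume) ψ) hf
    simpa using! this
  have key : ∀ g : Lp (α := ℝ) ℂ 2 volume, ∫⁻ x, ‖g x‖ₑ ^ 2 = ‖g‖ₑ ^ 2 := fun g => by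
    rw [Lp.enorm_def, eLpNorm_eq_lintegral_rpow_enorm_toReal (by norm_num) (by norm_num)]
    simp only [ENNReal.toReal_ofNat, ENNReal.rpow_ofNat, one_div]
    rw [← ENNReal.rpow_natCast, ← ENNReal.rpow_mul]
    norm_num
  calc ∫⁻ x, ‖𝓕 f x‖ₑ ^ 2 = ∫⁻ x, ‖(𝓕 L : Lp (α := ℝ) ℂ 2 volume) x‖ₑ ^ 2 :=
        lintegral_congr_ae (by filter_upwards [hae] with x hx; rw [hx])
    _ = ∫⁻ x, ‖L x‖ₑ ^ 2 := by
        rw [key, key]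
        congr 1
        rw [← ofReal_norm, Lp.norm_fourier_eq, ofReal_norm]
    _ = _ := lintegral_congr_ae (by filter_upwards [hf2.coeFn_toLp] with x hx; rw [hL, hx])

theorem lintegral_comp_mul_left (g : ℝ → ℝ≥0∞) {a : ℝ} (ha : a ≠ 0) :
    ∫⁻ x, g (a * x) = ENNReal.ofReal |a⁻¹| * ∫⁻ x, g x := by
  have h : ∫⁻ y, g y ∂(Measure.map (fun x => a * x) volume) = ∫⁻ x, g (a * x) :=
    (Homeomorph.mulLeft₀ a ha).measurableEmbedding.lintegral_map g
  rw [← h, Real.map_volume_mul_left ha, lintegral_smul_measure, smul_eq_mul]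

/-- Plancherel's inequality for the integral transform of an integrable function. -/
theorem lintegral_norm_timeWave_sq_le {f : ℝ → ℂ} (hf : Integrable f) :
    ∫⁻ t, ‖timeWave f t‖ₑ ^ 2 ≤ ENNReal.ofReal (2 * Real.pi) * ∫⁻ σ, ‖f σ‖ₑ ^ 2 := by
  have hpi : 0 < 2 * Real.pi := by positivity
  by_cases htop : ∫⁻ σ, ‖f σ‖ₑ ^ 2 = ∞
  · rw [htop, ENNReal.mul_top (by simpa using Real.pi_pos)]
    exact le_top
  have hf2 : MemLp f 2 := by
    refine ⟨hf.1, ?_⟩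
    rw [eLpNorm_eq_lintegral_rpow_enorm_toReal (by norm_num) (by norm_num)]
    simp only [ENNReal.toReal_ofNat, ENNReal.rpow_ofNat, one_div]
    exact ENNReal.rpow_lt_top_of_nonneg (by norm_num) htop
  simp only [timeWave_eq_fourier]
  rw [lintegral_comp_mul_left (fun x => ‖𝓕 f x‖ₑ ^ 2) (neg_ne_zero.2 (inv_ne_zero hpi.ne')),
    lintegral_norm_fourier_sq hf hf2, inv_neg, inv_inv, abs_neg, abs_of_pos hpi]

open scoped Convolution

theorem timeWave_mul_timeWave {f g : ℝ → ℂ} (hf : Integrable f) (hg : Integrable g) (t : ℝ) :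
    timeWave f t * timeWave g t = timeWave (fun τ => ∫ σ, f σ * g (τ - σ)) t := by
  rw [timeWave_eq_fourier, timeWave_eq_fourier, timeWave_eq_fourier,
    ← Real.fourier_mul_convolution_eq hf hg]
  rfl

theorem integrable_convolution_mul {f g : ℝ → ℂ} (hf : Integrable f) (hg : Integrable g) :
    Integrable fun τ => ∫ σ, f σ * g (τ - σ) :=
  hf.integrable_convolution (ContinuousLinearMap.mul ℂ ℂ) hg

/-- The multiplication formula moves the transform from the reflection of `f` onto `𝓕 ψ`, and `𝓕 (𝓕
ψ)` is the reflection of `ψ`. The factor `2π` is the Jacobian of the change of frequency convention.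
-/
theorem integral_timeFourier_mul_timeWave {f : ℝ → ℂ} (hf : Integrable f) (ψ : 𝓢(ℝ, ℂ)) :
    ∫ t, timeFourier ψ t * timeWave f t = 2 * Real.pi * ∫ σ, ψ σ * f σ := by
  have hpi : 0 < 2 * Real.pi := by positivity
  have h1 : ∀ t, timeFourier ψ t * timeWave f t
      = (fun s => 𝓕 ψ s * 𝓕 (fun x => f (-x)) s) ((2 * Real.pi)⁻¹ * t) := fun t => by
    rw [timeFourier_eq_fourier, timeWave_eq_fourier, neg_mul, ← Real.fourierInv_eq_fourier_neg,
      Real.fourierInv_eq_fourier_comp_neg]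
  simp only [h1]
  rw [Measure.integral_comp_mul_left (fun s => 𝓕 ψ s * 𝓕 (fun x => f (-x)) s) (2 * Real.pi)⁻¹]
  have h2 := VectorFourier.integral_bilin_fourierIntegral_eq_flip (ContinuousLinearMap.mul ℂ ℂ)
      (L := innerₗ ℝ) Real.continuous_fourierChar continuous_inner
      (SchwartzMap.integrable (μ := volume) (𝓕 ψ)) hf.comp_neg
  have h3 : ∫ s, 𝓕 ψ s * 𝓕 (fun x => f (-x)) s = ∫ s, 𝓕 (𝓕 ψ) s * f (-s) := by
    simpa using! h2.symm
  rw [h3, inv_inv, abs_of_pos hpi, Complex.real_smul]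
  push_cast
  congr 1
  rw [← integral_neg_eq_self]
  refine integral_congr_ae (Filter.Eventually.of_forall fun s => ?_)
  simp only [neg_neg]
  congr 1
  have h4 : (𝓕⁻ (𝓕 ψ)) s = ψ s := by rw [FourierTransform.fourierInv_fourier_eq]
  rw [← h4, SchwartzMap.fourierInv_coe, Real.fourierInv_eq_fourier_neg, SchwartzMap.fourier_coe (𝓕 ψ)]

/-- Dilation of a Schwartz function. -/
theorem exists_schwartz_comp_mul_left (φ : 𝓢(ℝ, ℂ)) {a : ℝ} (ha : a ≠ 0) :
    ∃ φ' : 𝓢(ℝ, ℂ), ∀ t, φ' t = φ (a * t) :=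
  ⟨SchwartzMap.compCLMOfContinuousLinearEquiv ℂ
    (ContinuousLinearEquiv.unitsEquivAut ℝ (Units.mk0 a ha)) φ, fun t => by simp [mul_comm]⟩

theorem exists_schwartz_eq_timeFourier (ψ : 𝓢(ℝ, ℂ)) : ∃ φ : 𝓢(ℝ, ℂ), ∀ t, φ t = timeFourier ψ t := by
  obtain ⟨φ, hφ⟩ := exists_schwartz_comp_mul_left (𝓕 ψ)
    (inv_ne_zero (by positivity : (2 * Real.pi) ≠ 0))
  exact ⟨φ, fun t => by rw [hφ, timeFourier_eq_fourier]⟩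

/-- By this surjectivity, testing against transforms of Schwartz functions is testing against all
Schwartz functions of time. -/
theorem exists_timeFourier_eq_schwartz (φ : 𝓢(ℝ, ℂ)) : ∃ ψ : 𝓢(ℝ, ℂ), ∀ t, timeFourier ψ t = φ t := by
  have hpi : (2 * Real.pi) ≠ 0 := by positivity
  obtain ⟨φ', hφ⟩ := exists_schwartz_comp_mul_left φ hpi
  refine ⟨𝓕⁻ φ', fun t => ?_⟩
  rw [timeFourier_eq_fourier, FourierTransform.fourier_fourierInv_eq, hφ, mul_inv_cancel_left₀ hpi]

end TimeFourier

/-! ### Weighted convolution estimates in frequency space -/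

section WeightedYoung

open scoped ENNReal

theorem ENNReal.sq_lintegral_mul_le {α : Type*} [MeasurableSpace α] (μ : Measure α) {f g : α → ℝ≥0∞}
    (hf : AEMeasurable f μ) (hg : AEMeasurable g μ) :
    (∫⁻ a, f a * g a ∂μ) ^ 2 ≤ (∫⁻ a, f a ^ 2 ∂μ) * ∫⁻ a, g a ^ 2 ∂μ := by
  have h := ENNReal.lintegral_mul_le_Lp_mul_Lq μ Real.HolderConjugate.two_two hf hg
  simp only [Pi.mul_apply, ENNReal.rpow_ofNat] at h
  calc (∫⁻ a, f a * g a ∂μ) ^ 2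
      ≤ ((∫⁻ a, f a ^ 2 ∂μ) ^ (1 / 2 : ℝ) * (∫⁻ a, g a ^ 2 ∂μ) ^ (1 / 2 : ℝ)) ^ 2 := by gcongr
    _ = _ := by
      rw [mul_pow, ← ENNReal.rpow_natCast, ← ENNReal.rpow_mul, ← ENNReal.rpow_natCast,
        ← ENNReal.rpow_mul]
      norm_num

theorem ENNReal.sq_tsum_mul_le {ι : Type*} (f g : ι → ℝ≥0∞) :
    (∑' i, f i * g i) ^ 2 ≤ (∑' i, f i ^ 2) * ∑' i, g i ^ 2 := by
  let _ : MeasurableSpace ι := ⊤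
  have h := ENNReal.sq_lintegral_mul_le (Measure.count : Measure ι) (f := f) (g := g)
    (measurable_from_top.aemeasurable) (measurable_from_top.aemeasurable)
  simpa only [lintegral_count] using h

theorem ENNReal.sq_tsum_lintegral_mul_le {ι α : Type*} [MeasurableSpace α] (μ : Measure α)
    {f g : ι → α → ℝ≥0∞} (hf : ∀ i, AEMeasurable (f i) μ) (hg : ∀ i, AEMeasurable (g i) μ) :
    (∑' i, ∫⁻ a, f i a * g i a ∂μ) ^ 2 ≤
      (∑' i, ∫⁻ a, f i a ^ 2 ∂μ) * ∑' i, ∫⁻ a, g i a ^ 2 ∂μ := by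
  have hsq : ∀ x : ℝ≥0∞, (x ^ (1 / 2 : ℝ)) ^ 2 = x := fun x => by
    rw [← ENNReal.rpow_natCast, ← ENNReal.rpow_mul]; norm_num
  calc (∑' i, ∫⁻ a, f i a * g i a ∂μ) ^ 2
      ≤ (∑' i, (∫⁻ a, f i a ^ 2 ∂μ) ^ (1 / 2 : ℝ) * (∫⁻ a, g i a ^ 2 ∂μ) ^ (1 / 2 : ℝ)) ^ 2 := by
        gcongr with i
        rw [← ENNReal.mul_rpow_of_nonneg _ _ (by norm_num)]
        calc _ = ((∫⁻ a, f i a * g i a ∂μ) ^ 2) ^ (1 / 2 : ℝ) := by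
              rw [← ENNReal.rpow_natCast, ← ENNReal.rpow_mul]; norm_num
          _ ≤ _ := by gcongr; exact ENNReal.sq_lintegral_mul_le μ (hf i) (hg i)
    _ ≤ _ := by
        refine (ENNReal.sq_tsum_mul_le _ _).trans ?_
        simp only [hsq, le_refl]

/-- For fixed `(m, τ)`, multiply and divide by the weights and apply Cauchy–Schwarz in `(k, σ)`; the
reciprocal weights contribute at most `C`. The remaining convolution of squares has total mass equal
to the product of the two masses. -/
theorem tsum_lintegral_convolution_sq_le {F G W₁ W₂ : (Fin 2 → ℤ) → ℝ → ℝ≥0∞}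
    (hF : ∀ k, Measurable (F k)) (hG : ∀ k, Measurable (G k)) (hW₁ : ∀ k, Measurable (W₁ k))
    (hW₂ : ∀ k, Measurable (W₂ k)) (h₁0 : ∀ k σ, W₁ k σ ≠ 0) (h₁t : ∀ k σ, W₁ k σ ≠ ∞)
    (h₂0 : ∀ k σ, W₂ k σ ≠ 0) (h₂t : ∀ k σ, W₂ k σ ≠ ∞) {C : ℝ≥0∞}
    (hC : ∀ τ m, ∑' k, ∫⁻ σ, ((W₁ k σ * W₂ (m - k) (τ - σ))⁻¹) ^ 2 ≤ C) :
    ∑' m, ∫⁻ τ, (∑' k, ∫⁻ σ, F k σ * G (m - k) (τ - σ)) ^ 2 ≤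
      C * (∑' k, ∫⁻ σ, (W₁ k σ * F k σ) ^ 2) * ∑' k, ∫⁻ σ, (W₂ k σ * G k σ) ^ 2 := by
  have hpt : ∀ m τ, (∑' k, ∫⁻ σ, F k σ * G (m - k) (τ - σ)) ^ 2 ≤
      C * ∑' k, ∫⁻ σ, (W₁ k σ * F k σ) ^ 2 * (W₂ (m - k) (τ - σ) * G (m - k) (τ - σ)) ^ 2 := by
    intro m τ
    have hsplit : ∀ k σ, F k σ * G (m - k) (τ - σ) = (W₁ k σ * W₂ (m - k) (τ - σ))⁻¹ *
        ((W₁ k σ * F k σ) * (W₂ (m - k) (τ - σ) * G (m - k) (τ - σ))) := by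
      intro k σ
      rw [mul_mul_mul_comm (W₁ k σ), ← mul_assoc,
        ENNReal.inv_mul_cancel (mul_ne_zero (h₁0 _ _) (h₂0 _ _))
          (ENNReal.mul_ne_top (h₁t _ _) (h₂t _ _)), one_mul]
    simp only [hsplit]
    refine (ENNReal.sq_tsum_lintegral_mul_le volume (fun k => ?_) (fun k => ?_)).trans ?_
    · have := hW₁ k; have := hW₂ (m - k); fun_prop
    · have := hW₁ k; have := hW₂ (m - k); have := hF k; have := hG (m - k); fun_prop
    · simp only [← mul_pow]
      gcongr
      exact hC τ m
  have hmeas : ∀ k m, Measurable fun p : ℝ × ℝ =>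
      (W₁ k p.2 * F k p.2) ^ 2 * (W₂ (m - k) (p.1 - p.2) * G (m - k) (p.1 - p.2)) ^ 2 := fun k m => by
    have := hW₁ k; have := hW₂ (m - k); have := hF k; have := hG (m - k); fun_prop
  calc ∑' m, ∫⁻ τ, (∑' k, ∫⁻ σ, F k σ * G (m - k) (τ - σ)) ^ 2
      ≤ ∑' m, ∫⁻ τ, C * ∑' k, ∫⁻ σ, (W₁ k σ * F k σ) ^ 2 *
          (W₂ (m - k) (τ - σ) * G (m - k) (τ - σ)) ^ 2 := by
        gcongr with m τ; exact hpt m τ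
    _ = C * ∑' m, ∑' k, ∫⁻ σ, (W₁ k σ * F k σ) ^ 2 * ∫⁻ τ, (W₂ (m - k) τ * G (m - k) τ) ^ 2 := by
        rw [← ENNReal.tsum_mul_left]
        refine tsum_congr fun m => ?_
        rw [lintegral_const_mul _ (Measurable.tsum fun k => (hmeas k m).lintegral_prod_right'),
          lintegral_tsum fun k => (hmeas k m).lintegral_prod_right'.aemeasurable]
        congr 1
        refine tsum_congr fun k => ?_
        rw [lintegral_lintegral_swap (hmeas k m).aemeasurable]
        refine lintegral_congr fun σ => ?_
        have hW := hW₂ (m - k); have hG' := hG (m - k)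
        dsimp only
        rw [lintegral_const_mul _ (by fun_prop),
          lintegral_sub_right_eq_self (fun τ => (W₂ (m - k) τ * G (m - k) τ) ^ 2)]
    _ = C * ∑' k, ∑' m, (∫⁻ σ, (W₁ k σ * F k σ) ^ 2) * ∫⁻ τ, (W₂ (m - k) τ * G (m - k) τ) ^ 2 := by
        rw [ENNReal.tsum_comm]
        congr 1
        refine tsum_congr fun k => tsum_congr fun m => ?_
        have := hW₁ k; have := hF k
        rw [lintegral_mul_const _ (by fun_prop)]
    _ = _ := by
        rw [mul_assoc]
        congr 1
        rw [← ENNReal.tsum_mul_right]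
        refine tsum_congr fun k => ?_
        rw [ENNReal.tsum_mul_left]
        congr 1
        exact (Equiv.subRight k).tsum_eq (fun m => ∫⁻ τ, (W₂ m τ * G m τ) ^ 2)

theorem bourgainWeight_pos (s b σ : ℝ) (k : Fin 2 → ℤ) : 0 < bourgainWeight s b σ k := by
  have h1 := one_le_sqrt_freqSq k
  have h2 := one_le_sqrt_one_add_sq (σ + freqSq k)
  unfold bourgainWeight
  positivity

theorem continuous_bourgainWeight (s b : ℝ) (k : Fin 2 → ℤ) :
    Continuous fun σ => bourgainWeight s b σ k := by
  unfold bourgainWeight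
  refine continuous_const.mul (Continuous.rpow_const (by fun_prop) fun σ => Or.inl ?_)
  exact (zero_lt_one.trans_le (one_le_sqrt_one_add_sq _)).ne'

theorem bourgainWeight_neg_two_mul (s b σ : ℝ) (k : Fin 2 → ℤ) :
    bourgainWeight (-(2 * s)) (-(2 * b)) σ k = (bourgainWeight s b σ k)⁻¹ ^ 2 := by
  have h1 := one_le_sqrt_freqSq k
  have h2 := one_le_sqrt_one_add_sq (σ + freqSq k)
  unfold bourgainWeight
  rw [Real.rpow_neg (by positivity), Real.rpow_neg (by positivity), mul_comm 2 s, mul_comm 2 b,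
    Real.rpow_mul (by positivity), Real.rpow_mul (by positivity), Real.rpow_two, Real.rpow_two]
  rw [mul_inv, mul_pow, inv_pow, inv_pow]

/-- `‖⟨k⟩^s ⟨σ + |k|²⟩^b U‖²` in `L²l²`. -/
noncomputable def weightedEnergy (s b : ℝ) (U : ℝ → (Fin 2 → ℤ) → ℂ) : ℝ≥0∞ :=
  ∑' k : Fin 2 → ℤ, ∫⁻ σ : ℝ, (ENNReal.ofReal (bourgainWeight s b σ k) * ‖U σ k‖ₑ) ^ 2

theorem weightedL2Norm_eq (s b : ℝ) (U : ℝ → (Fin 2 → ℤ) → ℂ) :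
    weightedL2Norm s b U = weightedEnergy s b U ^ (1 / 2 : ℝ) := rfl

theorem weightedL2Norm_sq (s b : ℝ) (U : ℝ → (Fin 2 → ℤ) → ℂ) :
    weightedL2Norm s b U ^ 2 = weightedEnergy s b U := by
  rw [weightedL2Norm_eq, ← ENNReal.rpow_natCast, ← ENNReal.rpow_mul]; norm_num

theorem exists_tsum_lintegral_convolution_sq_le {s b : ℝ} (hs : 0 < s) (hb : 1 / 4 < b)
    (hb' : b < 1 / 2) (hsb : 1 / 2 - s / 4 < b) :
    ∃ C : ℝ≥0∞, C ≠ ∞ ∧ ∀ f g : ℝ → (Fin 2 → ℤ) → ℂ,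
      (∀ k, Measurable fun σ => f σ k) → (∀ k, Measurable fun σ => g σ k) →
      ∑' m, ∫⁻ τ, (∑' k, ∫⁻ σ, ‖f σ k‖ₑ * ‖g (τ - σ) (m - k)‖ₑ) ^ 2 ≤
        C * weightedEnergy s b f * weightedEnergy 0 b g := by
  obtain ⟨C, hC, h⟩ := exists_bilinear_kernel_le hs hb hb' hsb
  refine ⟨C, hC, fun f g hf hg => ?_⟩
  refine tsum_lintegral_convolution_sq_le (F := fun k σ => ‖f σ k‖ₑ) (G := fun k σ => ‖g σ k‖ₑ)
    (W₁ := fun k σ => ENNReal.ofReal (bourgainWeight s b σ k))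
    (W₂ := fun k σ => ENNReal.ofReal (bourgainWeight 0 b σ k)) (fun k => (hf k).enorm)
    (fun k => (hg k).enorm) (fun k => (continuous_bourgainWeight _ _ k).measurable.ennreal_ofReal)
    (fun k => (continuous_bourgainWeight _ _ k).measurable.ennreal_ofReal)
    (fun k σ => by simpa using bourgainWeight_pos s b σ k) (fun k σ => ENNReal.ofReal_ne_top)
    (fun k σ => by simpa using bourgainWeight_pos 0 b σ k) (fun k σ => ENNReal.ofReal_ne_top)
    fun τ m => ?_
  refine le_of_eq_of_le (tsum_congr fun k => lintegral_congr fun σ => ?_) (h τ m)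
  have h1 := bourgainWeight_pos s b σ k
  have h2 := bourgainWeight_pos 0 b (τ - σ) (m - k)
  have h3 := bourgainWeight_neg_two_mul 0 b (τ - σ) (m - k)
  rw [mul_zero, neg_zero] at h3
  rw [← ENNReal.ofReal_mul h1.le, ← ENNReal.ofReal_inv_of_pos (by positivity),
    ← ENNReal.ofReal_pow (by positivity), bourgainWeight_neg_two_mul, h3, mul_inv, mul_pow]

end WeightedYoung

/-! ### Characters and Parseval's identity on the torus -/

section Torus

open scoped ENNReal

theorem torusChar_add (k l : Fin 2 → ℤ) (x : Torus2) :
    torusChar (k + l) x = torusChar k x * torusChar l x := by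
  simp only [torusChar, Pi.add_apply, neg_add, fourier_add, Finset.prod_mul_distrib]

theorem torusChar_zero (x : Torus2) : torusChar 0 x = 1 := by
  simp [torusChar]

theorem torusChar_neg (k : Fin 2 → ℤ) (x : Torus2) :
    torusChar (-k) x = (starRingEnd ℂ) (torusChar k x) := by
  simp only [torusChar, Pi.neg_apply, map_prod, ← fourier_neg]

theorem norm_torusChar (k : Fin 2 → ℤ) (x : Torus2) : ‖torusChar k x‖ = 1 := by
  rw [torusChar, norm_prod]
  exact Finset.prod_eq_one fun j _ => Circle.norm_coe _

@[fun_prop]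
theorem continuous_torusChar (k : Fin 2 → ℤ) : Continuous (torusChar k) := by
  unfold torusChar; fun_prop

theorem integral_torusChar (k : Fin 2 → ℤ) :
    ∫ x, torusChar k x = if k = 0 then (2 * Real.pi : ℂ) ^ 2 else 0 := by
  have h1 : ∀ n : ℤ, ∫ x : AddCircle (2 * Real.pi), fourier n x
      = if n = 0 then (2 * Real.pi : ℂ) else 0 := by
    intro n
    split_ifs with h
    · subst h
      simp only [fourier_zero, integral_const, Measure.real, AddCircle.measure_univ]
      rw [ENNReal.toReal_ofReal (by positivity)]
      simp
    · exact integral_eq_zero_of_add_right_eq_neg (fourier_add_half_inv_index h Real.two_pi_pos)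
  unfold torusChar
  rw [integral_fintype_prod_volume_eq_prod
    (f := fun j => (fun x : AddCircle (2 * Real.pi) => fourier (-(k j)) x))]
  simp only [h1, Fin.prod_univ_two, neg_eq_zero]
  by_cases hk : k = 0
  · simp [hk, sq]
  · have : k 0 ≠ 0 ∨ k 1 ≠ 0 := by
      by_contra! h
      exact hk (funext fun i => by fin_cases i <;> simp [h.1, h.2])
    rcases this with h | h <;> simp [hk, h]

theorem integral_normSq_sum_torusChar (S : Finset (Fin 2 → ℤ)) (a : (Fin 2 → ℤ) → ℂ) :
    ∫ x, ‖∑ k ∈ S, a k * torusChar (-k) x‖ ^ 2 = (2 * Real.pi) ^ 2 * ∑ k ∈ S, ‖a k‖ ^ 2 := by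
  have h : ∀ x, ((‖∑ k ∈ S, a k * torusChar (-k) x‖ ^ 2 : ℝ) : ℂ) =
      ∑ k ∈ S, ∑ l ∈ S, a k * (starRingEnd ℂ) (a l) * torusChar (-k + l) x := by
    intro x
    rw [Complex.ofReal_pow, ← Complex.mul_conj', map_sum, Finset.sum_mul_sum]
    refine Finset.sum_congr rfl fun k _ => Finset.sum_congr rfl fun l _ => ?_
    rw [map_mul, ← torusChar_neg, neg_neg, torusChar_add]
    ring
  have hint : ∀ k : Fin 2 → ℤ, Integrable (torusChar k) := fun k =>
    (continuous_torusChar k).integrable_of_hasCompactSupport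
      (HasCompactSupport.of_compactSpace _)
  apply Complex.ofReal_injective
  rw [← integral_complex_ofReal]
  simp only [h]
  rw [integral_finsetSum _ fun k _ => integrable_finsetSum _ fun l _ => (hint _).const_mul _]
  push_cast
  rw [Finset.mul_sum]
  refine Finset.sum_congr rfl fun k hk => ?_
  rw [integral_finsetSum _ fun l _ => (hint _).const_mul _]
  simp only [integral_const_mul, integral_torusChar]
  rw [Finset.sum_eq_single_of_mem k hk fun l _ hl => by
    rw [if_neg (fun h => hl (neg_add_eq_zero.1 h).symm), mul_zero]]
  rw [neg_add_cancel, if_pos rfl, Complex.mul_conj']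
  ring

theorem lintegral_normSq_sum_torusChar (S : Finset (Fin 2 → ℤ)) (a : (Fin 2 → ℤ) → ℂ) :
    ∫⁻ x, ‖∑ k ∈ S, a k * torusChar (-k) x‖ₑ ^ 2
      = ENNReal.ofReal ((2 * Real.pi) ^ 2) * ∑ k ∈ S, ‖a k‖ₑ ^ 2 := by
  have h1 : ∀ z : ℂ, ‖z‖ₑ ^ 2 = ENNReal.ofReal (‖z‖ ^ 2) := fun z => by
    rw [ENNReal.ofReal_pow (norm_nonneg _), ofReal_norm]
  simp only [h1]
  rw [← ofReal_integral_eq_lintegral_ofReal, integral_normSq_sum_torusChar,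
    ENNReal.ofReal_mul (by positivity), ENNReal.ofReal_sum_of_nonneg fun k _ => by positivity]
  · exact (by fun_prop : Continuous fun x => ‖∑ k ∈ S, a k * torusChar (-k) x‖ ^ 2)
      |>.integrable_of_hasCompactSupport (HasCompactSupport.of_compactSpace _)
  · exact Filter.Eventually.of_forall fun x => by positivity

end Torus

/-! ### Products of trigonometric sums -/

section SpaceTimeWave

open scoped ENNReal Pointwise

/-- The trigonometric sum `∑_{k ∈ S} e^{i⟨k,x⟩} ∫ f(σ,k) e^{iσt} dσ`. -/
noncomputable def spaceTimeWave (S : Finset (Fin 2 → ℤ)) (f : ℝ → (Fin 2 → ℤ) → ℂ)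
    (p : ℝ × Torus2) : ℂ :=
  ∑ k ∈ S, timeWave (fun σ => f σ k) p.1 * torusChar (-k) p.2

theorem continuous_spaceTimeWave (S : Finset (Fin 2 → ℤ)) {f : ℝ → (Fin 2 → ℤ) → ℂ}
    (hf : ∀ k, Integrable fun σ => f σ k) : Continuous (spaceTimeWave S f) := by
  refine continuous_finsetSum _ fun k _ => ?_
  exact ((continuous_timeWave (hf k)).comp continuous_fst).mul
    ((continuous_torusChar (-k)).comp continuous_snd)

/-- Parseval in `x` at each time gives `(2π)²`, and Plancherel in `t` gives the last factor `2π`. -/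
theorem lintegral_spaceTimeWave_sq_le (S : Finset (Fin 2 → ℤ)) {f : ℝ → (Fin 2 → ℤ) → ℂ}
    (hf : ∀ k, Integrable fun σ => f σ k) :
    ∫⁻ p, ‖spaceTimeWave S f p‖ₑ ^ 2 ≤
      ENNReal.ofReal ((2 * Real.pi) ^ 3) * ∑ k ∈ S, ∫⁻ σ, ‖f σ k‖ₑ ^ 2 := by
  have hc := continuous_spaceTimeWave S hf
  rw [Measure.volume_eq_prod, lintegral_prod _ (by fun_prop)]
  simp only [spaceTimeWave, lintegral_normSq_sum_torusChar]
  have hm : ∀ k, Measurable fun t => ‖timeWave (fun σ => f σ k) t‖ₑ ^ 2 := fun k => by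
    have := continuous_timeWave (hf k); fun_prop
  rw [lintegral_const_mul _ (Finset.measurable_fun_sum _ fun k _ => hm k),
    lintegral_finsetSum _ fun k _ => hm k, pow_succ (2 * Real.pi) 2, ENNReal.ofReal_mul (by positivity),
    mul_assoc]
  gcongr
  rw [Finset.mul_sum]
  gcongr with k
  exact lintegral_norm_timeWave_sq_le (hf k)

/-- The convolution in `ℝ × ℤ²`, for a first factor with frequencies in `S`. -/
noncomputable def spectralConvolution (S : Finset (Fin 2 → ℤ)) (f g : ℝ → (Fin 2 → ℤ) → ℂ) (τ : ℝ)
    (m : Fin 2 → ℤ) : ℂ :=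
  ∑ k ∈ S, ∫ σ, f σ k * g (τ - σ) (m - k)

theorem integrable_spectralConvolution (S : Finset (Fin 2 → ℤ)) {f g : ℝ → (Fin 2 → ℤ) → ℂ}
    (hf : ∀ k, Integrable fun σ => f σ k) (hg : ∀ k, Integrable fun σ => g σ k) (m : Fin 2 → ℤ) :
    Integrable fun τ => spectralConvolution S f g τ m :=
  integrable_finsetSum _ fun k _ => integrable_convolution_mul (hf k) (hg (m - k))

theorem timeWave_zero (t : ℝ) : timeWave (fun _ => 0) t = 0 := by
  simp [timeWave]

theorem timeWave_sum {ι : Type*} (S : Finset ι) {f : ι → ℝ → ℂ} (hf : ∀ i ∈ S, Integrable (f i))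
    (t : ℝ) : timeWave (fun σ => ∑ i ∈ S, f i σ) t = ∑ i ∈ S, timeWave (f i) t := by
  unfold timeWave
  simp only [Finset.sum_mul]
  refine integral_finsetSum _ fun i hi => ?_
  refine (hf i hi).mul_bdd (c := 1) (by fun_prop) (Filter.Eventually.of_forall fun σ => ?_)
  rw [show Complex.I * σ * t = ((σ * t : ℝ) : ℂ) * Complex.I by push_cast; ring,
    Complex.norm_exp_ofReal_mul_I]

/-- Characters and time waves both turn products into convolutions. As `g` vanishes off `T`, the sum
over `l ∈ T` can be rewritten over `m = k + l` in the set `S + T`, which does not depend on `k`. -/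
theorem spaceTimeWave_mul (S T : Finset (Fin 2 → ℤ)) {f g : ℝ → (Fin 2 → ℤ) → ℂ}
    (hf : ∀ k, Integrable fun σ => f σ k) (hg : ∀ k, Integrable fun σ => g σ k)
    (hT : ∀ k ∉ T, ∀ σ, g σ k = 0) (p : ℝ × Torus2) :
    spaceTimeWave S f p * spaceTimeWave T g p
      = spaceTimeWave (S + T) (spectralConvolution S f g) p := by
  have hshift : ∀ k ∈ S, ∑ l ∈ T, timeWave (fun σ => g σ l) p.1 * torusChar (-(k + l)) p.2 =
      ∑ m ∈ S + T, timeWave (fun σ => g σ (m - k)) p.1 * torusChar (-m) p.2 := by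
    intro k hk
    rw [← Finset.sum_subset (s₁ := T.image (k + ·)) (s₂ := S + T)]
    · rw [Finset.sum_image fun a _ b _ h => add_left_cancel h]
      simp
    · intro m hm
      obtain ⟨l, hl, rfl⟩ := Finset.mem_image.1 hm
      exact Finset.add_mem_add hk hl
    · intro m _ hm
      have : m - k ∉ T := fun h => hm (Finset.mem_image.2 ⟨m - k, h, by simp⟩)
      simp only [hT _ this, timeWave_zero, zero_mul]
  calc spaceTimeWave S f p * spaceTimeWave T g p
      = ∑ k ∈ S, timeWave (fun σ => f σ k) p.1 *
          ∑ l ∈ T, timeWave (fun σ => g σ l) p.1 * torusChar (-(k + l)) p.2 := by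
        rw [spaceTimeWave, spaceTimeWave, Finset.sum_mul]
        refine Finset.sum_congr rfl fun k _ => ?_
        rw [Finset.mul_sum, Finset.mul_sum]
        refine Finset.sum_congr rfl fun l _ => ?_
        rw [neg_add, torusChar_add]; ring
    _ = ∑ k ∈ S, ∑ m ∈ S + T, timeWave (fun τ => ∫ σ, f σ k * g (τ - σ) (m - k)) p.1 *
          torusChar (-m) p.2 := by
        refine Finset.sum_congr rfl fun k hk => ?_
        rw [hshift k hk, Finset.mul_sum]
        refine Finset.sum_congr rfl fun m _ => ?_
        rw [← mul_assoc, timeWave_mul_timeWave (hf k) (hg (m - k))]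
    _ = _ := by
        rw [Finset.sum_comm, spaceTimeWave]
        refine Finset.sum_congr rfl fun m _ => ?_
        rw [← Finset.sum_mul]
        congr 1
        exact (timeWave_sum S (fun k _ => integrable_convolution_mul (hf k) (hg (m - k))) p.1).symm

theorem enorm_spectralConvolution_le (S : Finset (Fin 2 → ℤ)) (f g : ℝ → (Fin 2 → ℤ) → ℂ) (τ : ℝ)
    (m : Fin 2 → ℤ) : ‖spectralConvolution S f g τ m‖ₑ ≤
      ∑' k, ∫⁻ σ, ‖f σ k‖ₑ * ‖g (τ - σ) (m - k)‖ₑ := by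
  refine (enorm_sum_le _ _).trans (le_trans ?_ (ENNReal.sum_le_tsum S))
  gcongr with k
  refine (enorm_integral_le_lintegral_enorm _).trans (le_of_eq ?_)
  simp only [enorm_mul]

/-- The bilinear `L²` estimate for trigonometric sums. -/
theorem exists_lintegral_spaceTimeWave_mul_sq_le {s b : ℝ} (hs : 0 < s) (hb : 1 / 4 < b)
    (hb' : b < 1 / 2) (hsb : 1 / 2 - s / 4 < b) :
    ∃ C : ℝ≥0∞, C ≠ ∞ ∧ ∀ (S T : Finset (Fin 2 → ℤ)) (f g : ℝ → (Fin 2 → ℤ) → ℂ),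
      (∀ k, Measurable fun σ => f σ k) → (∀ k, Measurable fun σ => g σ k) →
      (∀ k, Integrable fun σ => f σ k) → (∀ k, Integrable fun σ => g σ k) →
      (∀ k ∉ T, ∀ σ, g σ k = 0) →
      ∫⁻ p, ‖spaceTimeWave S f p * spaceTimeWave T g p‖ₑ ^ 2 ≤
        C * weightedEnergy s b f * weightedEnergy 0 b g := by
  obtain ⟨C, hC, h⟩ := exists_tsum_lintegral_convolution_sq_le hs hb hb' hsb
  refine ⟨ENNReal.ofReal ((2 * Real.pi) ^ 3) * C, ENNReal.mul_ne_top ENNReal.ofReal_ne_top hC,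
    fun S T f g hfm hgm hf hg hT => ?_⟩
  simp only [spaceTimeWave_mul S T hf hg hT]
  refine (lintegral_spaceTimeWave_sq_le _ (integrable_spectralConvolution S hf hg)).trans ?_
  rw [mul_assoc, mul_assoc, ← mul_assoc C]
  gcongr
  refine le_trans ?_ (h f g hfm hgm)
  refine (ENNReal.sum_le_tsum _).trans ?_
  gcongr with m τ
  exact enorm_spectralConvolution_le S f g τ m

end SpaceTimeWave

/-! ### Uniqueness of the space-time Fourier transform -/

section Uniqueness

open scoped ENNReal SchwartzMap Topology ContDiff

/-- `torusChar k` as a bundled continuous function. -/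
noncomputable def torusCharMap (k : Fin 2 → ℤ) : C(Torus2, ℂ) := ⟨torusChar k, continuous_torusChar k⟩

theorem torusChar_single (i : Fin 2) (x : Torus2) :
    torusChar (Pi.single i (-1)) x = fourier 1 (x i) := by
  rw [torusChar, Finset.prod_eq_single i]
  · simp
  · intro j _ hj
    simp [Pi.single_eq_of_ne hj]
  · simp

/-- The star subalgebra of `C(𝕋², ℂ)` generated by the characters. -/
noncomputable def torusCharSubalgebra : StarSubalgebra ℂ C(Torus2, ℂ) where
  toSubalgebra := Algebra.adjoin ℂ (Set.range torusCharMap)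
  star_mem' := by
    change Algebra.adjoin ℂ (Set.range torusCharMap) ≤ star (Algebra.adjoin ℂ (Set.range torusCharMap))
    refine Algebra.adjoin_le ?_
    rintro _ ⟨n, rfl⟩
    refine Algebra.subset_adjoin ⟨-n, ?_⟩
    ext1 x
    exact torusChar_neg n x

theorem torusCharSubalgebra_separatesPoints : torusCharSubalgebra.SeparatesPoints := by
  intro x y hxy
  rw [Ne, funext_iff, not_forall] at hxy
  obtain ⟨i, hi⟩ := hxy
  refine ⟨_, ⟨torusCharMap (Pi.single i (-1)), Algebra.subset_adjoin ⟨_, rfl⟩, rfl⟩, ?_⟩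
  change torusChar _ x ≠ torusChar _ y
  rw [torusChar_single, torusChar_single, fourier_one, fourier_one]
  exact fun h => hi (AddCircle.injective_toCircle Real.two_pi_pos.ne' (Circle.coe_injective h))

theorem torusCharSubalgebra_coe :
    torusCharSubalgebra.toSubalgebra.toSubmodule = Submodule.span ℂ (Set.range torusCharMap) := by
  apply Algebra.adjoin_eq_span_of_subset
  refine .trans (fun x ↦ Submonoid.closure_induction (fun _ ↦ id) ⟨0, ?_⟩ ?_) Submodule.subset_span
  · ext x; exact torusChar_zero x
  · rintro _ _ _ _ ⟨m, rfl⟩ ⟨n, rfl⟩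
    refine ⟨m + n, ?_⟩
    ext x
    exact torusChar_add m n x

/-- Stone–Weierstrass: the span of the characters is closed under products and conjugation, and
already the coordinate characters separate points. -/
theorem span_torusCharMap_closure_eq_top :
    (Submodule.span ℂ (Set.range torusCharMap)).topologicalClosure = ⊤ := by
  rw [← torusCharSubalgebra_coe]
  exact congr_arg (Subalgebra.toSubmodule <| StarSubalgebra.toSubalgebra ·)
    (ContinuousMap.starSubalgebra_topologicalClosure_eq_top_of_separatesPoints _
      torusCharSubalgebra_separatesPoints)

theorem integrable_mul_continuousMap {f : Torus2 → ℂ} (hf : Integrable f) (g : C(Torus2, ℂ)) :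
    Integrable fun x => f x * g x :=
  hf.mul_bdd (c := ‖g‖) g.continuous.aestronglyMeasurable
    (Filter.Eventually.of_forall g.norm_coe_le_norm)

theorem integral_mul_continuousMap_eq_zero {f : Torus2 → ℂ} (hf : Integrable f)
    (h : ∀ k, ∫ x, f x * torusChar k x = 0) (g : C(Torus2, ℂ)) : ∫ x, f x * g x = 0 := by
  let L : C(Torus2, ℂ) →L[ℂ] ℂ := LinearMap.mkContinuous
    { toFun := fun g => ∫ x, f x * g x
      map_add' := fun g₁ g₂ => by
        simp only [ContinuousMap.add_apply, mul_add]
        exact integral_add (integrable_mul_continuousMap hf g₁) (integrable_mul_continuousMap hf g₂)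
      map_smul' := fun c g => by
        simp only [ContinuousMap.smul_apply, smul_eq_mul, mul_left_comm _ c, integral_const_mul,
          RingHom.id_apply] } (∫ x, ‖f x‖) fun g => by
      change ‖∫ x, f x * g x‖ ≤ _
      refine (norm_integral_le_integral_norm _).trans ?_
      rw [← integral_mul_const]
      refine integral_mono (integrable_mul_continuousMap hf g).norm (hf.norm.mul_const _) fun x => ?_
      simp only [norm_mul]
      gcongr
      exact g.norm_coe_le_norm x
  have hL : L = 0 := by
    refine ContinuousLinearMap.ext_on (s := Set.range torusCharMap) ?_ ?_
    · rw [Submodule.dense_iff_topologicalClosure_eq_top]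
      exact span_torusCharMap_closure_eq_top
    · rintro _ ⟨k, rfl⟩
      exact h k
  exact congrArg (fun T : C(Torus2, ℂ) →L[ℂ] ℂ => T g) hL

/-- The integral against every continuous function vanishes; approximating indicators of closed sets
by continuous functions, so does the integral over every closed set. -/
theorem ae_eq_zero_of_integral_mul_torusChar_eq_zero {f : Torus2 → ℂ} (hf : Integrable f)
    (h : ∀ k, ∫ x, f x * torusChar k x = 0) : f =ᵐ[volume] 0 := by
  refine ae_eq_zero_of_forall_setIntegral_isClosed_eq_zero hf fun F hF => ?_
  rw [← integral_indicator hF.measurableSet]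
  have hlim : Filter.Tendsto (fun n => ∫ x, f x * ((hF.apprSeq n x : ℝ) : ℂ)) Filter.atTop
      (𝓝 (∫ x, F.indicator f x)) := by
    refine tendsto_integral_of_dominated_convergence (fun x => ‖f x‖) (fun n => ?_) hf.norm
      (fun n => Filter.Eventually.of_forall fun x => ?_) (Filter.Eventually.of_forall fun x => ?_)
    · exact hf.1.mul (Continuous.aestronglyMeasurable (by fun_prop))
    · rw [norm_mul]
      refine mul_le_of_le_one_right (norm_nonneg _) ?_
      have := HasOuterApproxClosed.apprSeq_apply_le_one hF n x
      simpa using this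
    · have h1 := (tendsto_pi_nhds.1 (HasOuterApproxClosed.tendsto_apprSeq hF)) x
      have h2 : Filter.Tendsto (fun n => f x * ((hF.apprSeq n x : ℝ) : ℂ)) Filter.atTop
          (𝓝 (f x * (((F.indicator (fun _ => (1 : NNReal)) x : NNReal) : ℝ) : ℂ))) :=
        ((Complex.continuous_ofReal.comp NNReal.continuous_coe).tendsto _ |>.comp h1).const_mul _
      convert! h2 using 2
      by_cases hx : x ∈ F <;> simp [hx]
  refine tendsto_nhds_unique hlim (tendsto_const_nhds.congr fun n => ?_)
  exact (integral_mul_continuousMap_eq_zero hf h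
    ⟨fun x => ((hF.apprSeq n x : ℝ) : ℂ), by fun_prop⟩).symm

theorem integrable_mul_torusChar {e : ℝ × Torus2 → ℂ} (he : Integrable e) (k : Fin 2 → ℤ) :
    Integrable fun p : ℝ × Torus2 => e p * torusChar k p.2 :=
  he.mul_bdd (c := 1) (Continuous.aestronglyMeasurable (by fun_prop))
    (Filter.Eventually.of_forall fun p => (norm_torusChar k p.2).le)

/-- For each `k` the spatial Fourier coefficient vanishes for almost every `t`. There are countably
many `k`, so for almost every `t` the whole slice vanishes. -/
theorem ae_eq_zero_of_integral_smul_mul_torusChar_eq_zero {e : ℝ × Torus2 → ℂ} (he : Integrable e)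
    (h : ∀ (k : Fin 2 → ℤ) (g : ℝ → ℝ), ContDiff ℝ ∞ g → HasCompactSupport g →
      ∫ p : ℝ × Torus2, (g p.1 : ℂ) * (e p * torusChar k p.2) = 0) : e =ᵐ[volume] 0 := by
  have hslice : ∀ k, ∀ᵐ t, ∫ x, e (t, x) * torusChar k x = 0 := by
    intro k
    have hint := integrable_mul_torusChar he k
    refine ae_eq_zero_of_integral_contDiff_smul_eq_zero
      (f := fun t => ∫ x, e (t, x) * torusChar k x)
      hint.integral_prod_left.locallyIntegrable fun g hg hgc => ?_
    rw [← h k g hg hgc, Measure.volume_eq_prod, integral_prod]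
    · refine integral_congr_ae (Filter.Eventually.of_forall fun t => ?_)
      simp only [Complex.real_smul, integral_const_mul]
    · obtain ⟨C, hC⟩ := hg.continuous.bounded_above_of_compact_support hgc
      refine hint.bdd_mul (c := C) ?_ (Filter.Eventually.of_forall fun p => ?_)
      · exact (Complex.continuous_ofReal.comp (hg.continuous.comp continuous_fst)).aestronglyMeasurable
      · simpa using hC p.1
  have hae : ∀ᵐ t, ∫⁻ x, ‖e (t, x)‖ₑ = 0 := by
    filter_upwards [ae_all_iff.2 hslice, he.prod_right_ae] with t ht hti
    rw [lintegral_congr_ae (g := fun _ => 0), lintegral_zero]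
    filter_upwards [ae_eq_zero_of_integral_mul_torusChar_eq_zero hti ht] with x hx
    simpa using hx
  have h0 : ∫⁻ p, ‖e p‖ₑ = 0 := by
    rw [Measure.volume_eq_prod, lintegral_prod _ he.1.enorm, lintegral_congr_ae hae, lintegral_zero]
  rw [lintegral_eq_zero_iff' he.1.enorm] at h0
  filter_upwards [h0] with p hp
  simpa using hp

/-- Two functions with the same space-time Fourier transform are equal almost everywhere. -/
theorem ae_eq_of_integral_timeFourier_eq {u v : ℝ × Torus2 → ℂ}
    (hu : ∀ ψ : 𝓢(ℝ, ℂ), Integrable fun p : ℝ × Torus2 => ψ p.1 * u p)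
    (hv : ∀ ψ : 𝓢(ℝ, ℂ), Integrable fun p : ℝ × Torus2 => ψ p.1 * v p)
    (h : ∀ (k : Fin 2 → ℤ) (ψ : 𝓢(ℝ, ℂ)), ∫ p : ℝ × Torus2, timeFourier ψ p.1 * (u p * torusChar k p.2)
      = ∫ p : ℝ × Torus2, timeFourier ψ p.1 * (v p * torusChar k p.2)) : u =ᵐ[volume] v := by
  -- The functions need not be integrable over all time, so they are localized by cutoffs equal to 1
  -- on `[-(n+1), n+1]`.
  let χ : ℕ → ContDiffBump (0 : ℝ) := fun n =>
    ⟨n + 1, n + 2, by positivity, by linarith⟩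
  have hsch : ∀ g : ℝ → ℝ, ContDiff ℝ ∞ g → HasCompactSupport g → ∃ ψ : 𝓢(ℝ, ℂ), ∀ t, ψ t = g t :=
    fun g hg hgc => ⟨(hgc.comp_left (g := fun x : ℝ => (x : ℂ)) Complex.ofReal_zero).toSchwartzMap
      (Complex.ofRealCLM.contDiff.comp hg), fun t => rfl⟩
  have hzero : ∀ n, (fun p : ℝ × Torus2 => (χ n p.1 : ℂ) * (u p - v p)) =ᵐ[volume] 0 := by
    intro n
    obtain ⟨ψ₀, hψ₀⟩ := hsch (χ n) (χ n).contDiff (χ n).hasCompactSupport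
    refine ae_eq_zero_of_integral_smul_mul_torusChar_eq_zero ?_ fun k g hg hgc => ?_
    · refine ((hu ψ₀).sub (hv ψ₀)).congr (Filter.Eventually.of_forall fun p => ?_)
      simp [hψ₀, mul_sub]
    · obtain ⟨φ, hφ⟩ := hsch (fun t => g t * χ n t) (hg.mul (χ n).contDiff) hgc.mul_right
      obtain ⟨ψ, hψ⟩ := exists_timeFourier_eq_schwartz φ
      have hk := sub_eq_zero.2 (h k ψ)
      simp only [hψ] at hk
      have hi : ∀ {w : ℝ × Torus2 → ℂ}, (∀ ψ : 𝓢(ℝ, ℂ), Integrable fun p : ℝ × Torus2 => ψ p.1 * w p) →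
          Integrable fun p : ℝ × Torus2 => φ p.1 * (w p * torusChar k p.2) := fun {w} hw => by
        refine (integrable_mul_torusChar (hw φ) k).congr (Filter.Eventually.of_forall fun p => ?_)
        simp only [mul_assoc]
      rw [← integral_sub (hi hu) (hi hv)] at hk
      rw [← hk]
      refine integral_congr_ae (Filter.Eventually.of_forall fun p => ?_)
      simp only [hφ]
      push_cast
      ring
  filter_upwards [ae_all_iff.2 hzero] with p hp
  obtain ⟨n, hn⟩ := exists_nat_ge |p.1|
  have h1 : χ n p.1 = 1 := (χ n).one_of_mem_closedBall (by
    simp only [Metric.mem_closedBall, dist_zero_right, Real.norm_eq_abs]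
    exact hn.trans (by simp [χ]))
  have := hp n
  rw [h1] at this
  simpa [sub_eq_zero] using this

end Uniqueness

/-! ### Approximation by trigonometric sums -/

section Approximation

open scoped ENNReal SchwartzMap Topology

theorem exists_schwartz_eq_one_of_abs_le (r : ℝ) : ∃ ψ : 𝓢(ℝ, ℂ), ∀ t, |t| ≤ r → ψ t = 1 := by
  let χ : ContDiffBump (0 : ℝ) :=
    ⟨|r| + 1, |r| + 2, by positivity, by linarith⟩
  refine ⟨(χ.hasCompactSupport.comp_left (g := fun x : ℝ => (x : ℂ)) Complex.ofReal_zero).toSchwartzMap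
    (Complex.ofRealCLM.contDiff.comp χ.contDiff), fun t ht => ?_⟩
  change ((χ t : ℝ) : ℂ) = 1
  rw [χ.one_of_mem_closedBall, Complex.ofReal_one]
  simp only [Metric.mem_closedBall, dist_zero_right, Real.norm_eq_abs]
  have := le_abs_self r
  change |t| ≤ |r| + 1
  linarith

/-- On `|σ| ≤ n` the function equals its product with a Schwartz cutoff, so it is a pointwise limit
of measurable functions. -/
theorem aestronglyMeasurable_of_forall_schwartz_mul {f : ℝ → ℂ}
    (h : ∀ ψ : 𝓢(ℝ, ℂ), Integrable fun σ => ψ σ * f σ) : AEStronglyMeasurable f := by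
  choose ψ hψ using fun n : ℕ => exists_schwartz_eq_one_of_abs_le n
  refine aestronglyMeasurable_of_tendsto_ae Filter.atTop (fun n => (h (ψ n)).1)
    (Filter.Eventually.of_forall fun σ => ?_)
  obtain ⟨n, hn⟩ := exists_nat_ge |σ|
  refine tendsto_const_nhds.congr' ?_
  filter_upwards [Filter.eventually_ge_atTop n] with m hm
  rw [hψ m σ (hn.trans (by exact_mod_cast hm)), one_mul]

/-- The Fourier transform has a representative that is measurable in `σ`. -/
theorem IsSpaceTimeFourier.exists_measurable {u : ℝ × Torus2 → ℂ} {U : ℝ → (Fin 2 → ℤ) → ℂ}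
    (h : IsSpaceTimeFourier u U) : ∃ U' : ℝ → (Fin 2 → ℤ) → ℂ, IsSpaceTimeFourier u U' ∧
      (∀ k, Measurable fun σ => U' σ k) ∧ ∀ s b, weightedEnergy s b U' = weightedEnergy s b U := by
  have hm : ∀ k, AEStronglyMeasurable fun σ => U σ k := fun k =>
    aestronglyMeasurable_of_forall_schwartz_mul (h.integrable_right k)
  have hae : ∀ k, (fun σ => U σ k) =ᵐ[volume] (hm k).mk := fun k => (hm k).ae_eq_mk
  refine ⟨fun σ k => (hm k).mk _ σ, ⟨h.integrable_left, fun k ψ => ?_, fun k ψ => ?_⟩,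
    fun k => (hm k).stronglyMeasurable_mk.measurable, fun s b => ?_⟩
  · refine (h.integrable_right k ψ).congr ?_
    filter_upwards [hae k] with σ hσ
    rw [hσ]
  · rw [h.integral_eq]
    refine integral_congr_ae ?_
    filter_upwards [hae k] with σ hσ
    rw [hσ]
  · refine tsum_congr fun k => lintegral_congr_ae ?_
    filter_upwards [hae k] with σ hσ
    rw [hσ]

theorem ENNReal.tendsto_tsum_of_dominated {ι : Type*} {f : ℕ → ι → ℝ≥0∞} {g bound : ι → ℝ≥0∞}
    (hb : ∑' i, bound i ≠ ∞) (hfb : ∀ n i, f n i ≤ bound i)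
    (hf : ∀ i, Filter.Tendsto (fun n => f n i) Filter.atTop (𝓝 (g i))) :
    Filter.Tendsto (fun n => ∑' i, f n i) Filter.atTop (𝓝 (∑' i, g i)) := by
  let _ : MeasurableSpace ι := ⊤
  have := tendsto_lintegral_of_dominated_convergence (μ := (Measure.count : Measure ι)) (F := f)
    (f := g) bound (fun n => measurable_from_top)
    (fun n => Filter.Eventually.of_forall (hfb n)) (by rwa [lintegral_count])
    (Filter.Eventually.of_forall hf)
  simpa only [lintegral_count] using this

/-- The frequencies `k ∈ ℤ²` with `|k_j| ≤ n`. -/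
noncomputable def frequencyBox (n : ℕ) : Finset (Fin 2 → ℤ) := Finset.Icc (fun _ => -(n : ℤ)) (fun _ => (n : ℤ))

theorem exists_mem_frequencyBox (k : Fin 2 → ℤ) : ∃ n, ∀ m, n ≤ m → k ∈ frequencyBox m := by
  refine ⟨(k 0).natAbs + (k 1).natAbs, fun m hm => ?_⟩
  rw [frequencyBox, Finset.mem_Icc, Pi.le_def, Pi.le_def]
  constructor <;> intro i <;> fin_cases i <;> simp <;> omega

theorem frequencyBox_mono {m n : ℕ} (h : m ≤ n) : frequencyBox m ⊆ frequencyBox n := by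
  intro k
  simp only [frequencyBox, Finset.mem_Icc, Pi.le_def]
  exact fun hk => ⟨fun i => by have := hk.1 i; omega, fun i => by have := hk.2 i; omega⟩

open Classical in
/-- Restriction to `|σ| ≤ n`, `|k_j| ≤ n`. -/
noncomputable def truncate (n : ℕ) (U : ℝ → (Fin 2 → ℤ) → ℂ) (σ : ℝ) (k : Fin 2 → ℤ) : ℂ :=
  if k ∈ frequencyBox n ∧ |σ| ≤ n then U σ k else 0

theorem truncate_eq_indicator (n : ℕ) (U : ℝ → (Fin 2 → ℤ) → ℂ) {k : Fin 2 → ℤ}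
    (hk : k ∈ frequencyBox n) :
    (fun σ => truncate n U σ k) = (Set.Icc (-(n : ℝ)) n).indicator fun σ => U σ k := by
  funext σ
  simp [truncate, hk, Set.indicator, abs_le]

theorem truncate_eq_zero (n : ℕ) (U : ℝ → (Fin 2 → ℤ) → ℂ) {k : Fin 2 → ℤ}
    (hk : k ∉ frequencyBox n) (σ : ℝ) : truncate n U σ k = 0 := by
  simp [truncate, hk]

theorem measurable_truncate (n : ℕ) {U : ℝ → (Fin 2 → ℤ) → ℂ} {k : Fin 2 → ℤ}
    (hU : Measurable fun σ => U σ k) : Measurable fun σ => truncate n U σ k := by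
  by_cases hk : k ∈ frequencyBox n
  · rw [truncate_eq_indicator n U hk]
    exact hU.indicator measurableSet_Icc
  · simp only [truncate_eq_zero n U hk, measurable_const]

theorem norm_truncate_le (n : ℕ) (U : ℝ → (Fin 2 → ℤ) → ℂ) (σ : ℝ) (k : Fin 2 → ℤ) :
    ‖truncate n U σ k‖ ≤ ‖U σ k‖ := by
  unfold truncate
  split_ifs <;> simp

theorem eventually_truncate_eq (U : ℝ → (Fin 2 → ℤ) → ℂ) (σ : ℝ) (k : Fin 2 → ℤ) :
    ∀ᶠ n in Filter.atTop, truncate n U σ k = U σ k := by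
  obtain ⟨n₁, hn₁⟩ := exists_mem_frequencyBox k
  obtain ⟨n₂, hn₂⟩ := exists_nat_ge |σ|
  filter_upwards [Filter.eventually_ge_atTop n₁, Filter.eventually_ge_atTop n₂] with n h1 h2
  rw [truncate, if_pos ⟨hn₁ n h1, hn₂.trans (by exact_mod_cast h2)⟩]

theorem memLp_two_of_lintegral_sq_ne_top {α : Type*} [MeasurableSpace α] {μ : Measure α} {f : α → ℂ}
    (hf : AEStronglyMeasurable f μ) (h : ∫⁻ a, ‖f a‖ₑ ^ 2 ∂μ ≠ ∞) : MemLp f 2 μ := by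
  refine ⟨hf, ?_⟩
  rw [eLpNorm_eq_lintegral_rpow_enorm_toReal (by norm_num) (by norm_num)]
  simp only [ENNReal.toReal_ofNat, ENNReal.rpow_ofNat, one_div]
  exact ENNReal.rpow_lt_top_of_nonneg (by norm_num) h

theorem eLpNorm_two_eq {α : Type*} [MeasurableSpace α] {μ : Measure α} (f : α → ℂ) :
    eLpNorm f 2 μ = (∫⁻ a, ‖f a‖ₑ ^ 2 ∂μ) ^ (1 / 2 : ℝ) := by
  rw [eLpNorm_eq_lintegral_rpow_enorm_toReal (by norm_num) (by norm_num)]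
  simp only [ENNReal.toReal_ofNat, ENNReal.rpow_ofNat]

theorem integrable_truncate (n : ℕ) {U : ℝ → (Fin 2 → ℤ) → ℂ} {k : Fin 2 → ℤ}
    (hU : Measurable fun σ => U σ k) (h : ∫⁻ σ, ‖U σ k‖ₑ ^ 2 ≠ ∞) :
    Integrable fun σ => truncate n U σ k := by
  by_cases hk : k ∈ frequencyBox n
  · rw [truncate_eq_indicator n U hk, integrable_indicator_iff measurableSet_Icc]
    exact ((memLp_two_of_lintegral_sq_ne_top hU.aestronglyMeasurable h).restrict _).integrable
      one_le_two
  · simp only [truncate_eq_zero n U hk]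
    exact integrable_zero _ _ _

/-- The squared `L²` norm of `U` outside `|σ| ≤ n`, `|k_j| ≤ n`. -/
noncomputable def truncationTail (n : ℕ) (U : ℝ → (Fin 2 → ℤ) → ℂ) : ℝ≥0∞ :=
  ∑' k, ∫⁻ σ, ‖U σ k - truncate n U σ k‖ₑ ^ 2

theorem norm_sub_truncate_le (n : ℕ) (U : ℝ → (Fin 2 → ℤ) → ℂ) (σ : ℝ) (k : Fin 2 → ℤ) :
    ‖U σ k - truncate n U σ k‖ ≤ ‖U σ k‖ := by
  unfold truncate
  split_ifs <;> simp

theorem tendsto_truncationTail {U : ℝ → (Fin 2 → ℤ) → ℂ} (hU : ∀ k, Measurable fun σ => U σ k)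
    (h : ∑' k, ∫⁻ σ, ‖U σ k‖ₑ ^ 2 ≠ ∞) :
    Filter.Tendsto (fun n => truncationTail n U) Filter.atTop (𝓝 0) := by
  have hle : ∀ n σ k, ‖U σ k - truncate n U σ k‖ₑ ^ 2 ≤ ‖U σ k‖ₑ ^ 2 := fun n σ k => by
    gcongr
    exact enorm_le_iff_norm_le.2 (norm_sub_truncate_le n U σ k)
  have := ENNReal.tendsto_tsum_of_dominated (g := fun _ => 0) h
    (f := fun n k => ∫⁻ σ, ‖U σ k - truncate n U σ k‖ₑ ^ 2)
    (fun n k => lintegral_mono fun σ => hle n σ k) fun k => by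
      have h0 : ∫⁻ _ : ℝ, (0 : ℝ≥0∞) = 0 := lintegral_zero
      rw [← h0]
      refine tendsto_lintegral_of_dominated_convergence (fun σ => ‖U σ k‖ₑ ^ 2) (fun n => ?_)
        (fun n => Filter.Eventually.of_forall fun σ => hle n σ k) (ENNReal.ne_top_of_tsum_ne_top h k)
        (Filter.Eventually.of_forall fun σ => ?_)
      · exact ((hU k).sub (measurable_truncate n (hU k))).enorm.pow_const 2
      · refine tendsto_const_nhds.congr' ?_
        filter_upwards [eventually_truncate_eq U σ k] with n hn
        simp [hn]
  rw [tsum_zero] at this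
  exact this

/-- Inside the box of size `N` both truncations equal `U`; outside it the right-hand side is `‖U‖`.
This yields a Cauchy bound by the tail at `N`. -/
theorem norm_truncate_sub_truncate_le {N n m : ℕ} (hn : N ≤ n) (hm : N ≤ m)
    (U : ℝ → (Fin 2 → ℤ) → ℂ) (σ : ℝ) (k : Fin 2 → ℤ) :
    ‖truncate n U σ k - truncate m U σ k‖ ≤ ‖U σ k - truncate N U σ k‖ := by
  have hNn : (N : ℝ) ≤ n := by exact_mod_cast hn
  have hNm : (N : ℝ) ≤ m := by exact_mod_cast hm
  by_cases hN : k ∈ frequencyBox N ∧ |σ| ≤ N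
  · rw [truncate, truncate, if_pos ⟨frequencyBox_mono hn hN.1, hN.2.trans hNn⟩,
      if_pos ⟨frequencyBox_mono hm hN.1, hN.2.trans hNm⟩]
    simp
  · rw [truncate, truncate, truncate, if_neg hN]
    split_ifs <;> simp

theorem spaceTimeWave_eq_of_subset {S T : Finset (Fin 2 → ℤ)} (hST : S ⊆ T)
    {f : ℝ → (Fin 2 → ℤ) → ℂ} (hf : ∀ k ∉ S, ∀ σ, f σ k = 0) (p : ℝ × Torus2) :
    spaceTimeWave S f p = spaceTimeWave T f p := by
  refine Finset.sum_subset hST fun k _ hk => ?_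
  simp only [hf k hk, timeWave_zero, zero_mul]

theorem integrable_mul_exp_I {f : ℝ → ℂ} (hf : Integrable f) (t : ℝ) :
    Integrable fun σ : ℝ => f σ * Complex.exp (Complex.I * σ * t) := by
  refine hf.mul_bdd (c := 1) (by fun_prop) (Filter.Eventually.of_forall fun σ => ?_)
  rw [show Complex.I * σ * t = ((σ * t : ℝ) : ℂ) * Complex.I by push_cast; ring,
    Complex.norm_exp_ofReal_mul_I]

theorem timeWave_sub {f g : ℝ → ℂ} (hf : Integrable f) (hg : Integrable g) (t : ℝ) :
    timeWave (fun σ => f σ - g σ) t = timeWave f t - timeWave g t := by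
  unfold timeWave
  rw [← integral_sub (integrable_mul_exp_I hf t) (integrable_mul_exp_I hg t)]
  simp only [sub_mul]

theorem spaceTimeWave_sub (S : Finset (Fin 2 → ℤ)) {f g : ℝ → (Fin 2 → ℤ) → ℂ}
    (hf : ∀ k, Integrable fun σ => f σ k) (hg : ∀ k, Integrable fun σ => g σ k) (p : ℝ × Torus2) :
    spaceTimeWave S (fun σ k => f σ k - g σ k) p = spaceTimeWave S f p - spaceTimeWave S g p := by
  simp only [spaceTimeWave, ← Finset.sum_sub_distrib, ← sub_mul, timeWave_sub (hf _) (hg _)]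

theorem integral_timeFourier_mul_spaceTimeWave {S : Finset (Fin 2 → ℤ)} {k : Fin 2 → ℤ} (hk : k ∈ S)
    {f : ℝ → (Fin 2 → ℤ) → ℂ} (hf : ∀ k, Integrable fun σ => f σ k) (ψ : 𝓢(ℝ, ℂ)) :
    ∫ p : ℝ × Torus2, timeFourier ψ p.1 * (spaceTimeWave S f p * torusChar k p.2)
      = (2 * Real.pi) ^ 3 * ∫ σ, ψ σ * f σ k := by
  obtain ⟨φ, hφ⟩ := exists_schwartz_eq_timeFourier ψ
  have hchar : ∀ l : Fin 2 → ℤ, Integrable (torusChar l) := fun l =>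
    (continuous_torusChar l).integrable_of_hasCompactSupport (HasCompactSupport.of_compactSpace _)
  have hint : ∀ l, Integrable fun t => timeFourier ψ t * timeWave (fun σ => f σ l) t := fun l => by
    simp only [← hφ]
    exact φ.integrable.mul_bdd (continuous_timeWave (hf l)).aestronglyMeasurable
      (Filter.Eventually.of_forall (norm_timeWave_le _))
  have hexp : ∀ p : ℝ × Torus2, timeFourier ψ p.1 * (spaceTimeWave S f p * torusChar k p.2) =
      ∑ l ∈ S, (timeFourier ψ p.1 * timeWave (fun σ => f σ l) p.1) * torusChar (-l + k) p.2 := by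
    intro p
    rw [spaceTimeWave, Finset.sum_mul, Finset.mul_sum]
    refine Finset.sum_congr rfl fun l _ => ?_
    rw [torusChar_add]; ring
  simp only [hexp, Measure.volume_eq_prod]
  rw [integral_finsetSum _ fun l _ => (hint l).mul_prod (hchar _)]
  rw [Finset.sum_congr rfl fun l _ => integral_prod_mul
    (fun t => timeFourier ψ t * timeWave (fun σ => f σ l) t) (torusChar (-l + k))]
  simp only [integral_torusChar]
  rw [Finset.sum_eq_single_of_mem k hk fun l _ hl => by
    rw [if_neg (fun h => hl (neg_add_eq_zero.1 h)), mul_zero]]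
  rw [neg_add_cancel, if_pos rfl, integral_timeFourier_mul_timeWave (hf k)]
  ring

/-- `u` is almost everywhere the limit of trigonometric sums whose data are dominated by `U`. -/
def IsWaveLimit (u : ℝ × Torus2 → ℂ) (U : ℝ → (Fin 2 → ℤ) → ℂ) : Prop :=
  ∃ (S : ℕ → Finset (Fin 2 → ℤ)) (f : ℕ → ℝ → (Fin 2 → ℤ) → ℂ),
    (∀ n k, Measurable fun σ => f n σ k) ∧ (∀ n k, Integrable fun σ => f n σ k) ∧
    (∀ n, ∀ k ∉ S n, ∀ σ, f n σ k = 0) ∧ (∀ n σ k, ‖f n σ k‖ ≤ ‖U σ k‖) ∧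
    ∀ᵐ p, Filter.Tendsto (fun n => spaceTimeWave (S n) (f n) p) Filter.atTop (𝓝 (u p))

/-- By Plancherel, the waves built from truncations of `U` form a Cauchy sequence in `L²`. Their
limit has the same space-time transform as `u`, hence equals `u` almost everywhere, and a
subsequence converges almost everywhere. -/
theorem IsSpaceTimeFourier.isWaveLimit {u : ℝ × Torus2 → ℂ} {U : ℝ → (Fin 2 → ℤ) → ℂ}
    (h : IsSpaceTimeFourier u U) (hU : ∀ k, Measurable fun σ => U σ k)
    (hU2 : ∑' k, ∫⁻ σ, ‖U σ k‖ₑ ^ 2 ≠ ∞) : MemLp u 2 ∧ IsWaveLimit u U := by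
  have hpi : (1 : ℝ) ≤ (2 * Real.pi) ^ 3 := one_le_pow₀ (by linarith [Real.pi_gt_three])
  -- The constant of Fourier inversion. Its modulus is at most 1, so the data remain dominated by
  -- `U` and no constant has to be carried along.
  set c : ℂ := ((2 * Real.pi : ℂ) ^ 3)⁻¹ with hc
  have hcn : ‖c‖ ≤ 1 := by
    have : c = ((((2 * Real.pi) ^ 3)⁻¹ : ℝ) : ℂ) := by rw [hc]; push_cast; rfl
    rw [this, Complex.norm_real, Real.norm_of_nonneg (by positivity)]
    exact inv_le_one_of_one_le₀ hpi
  have hc1 : (2 * Real.pi : ℂ) ^ 3 * c = 1 := by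
    rw [hc, mul_inv_cancel₀]
    have : (Real.pi : ℂ) ≠ 0 := by exact_mod_cast Real.pi_ne_zero
    exact pow_ne_zero _ (mul_ne_zero two_ne_zero this)
  set f : ℕ → ℝ → (Fin 2 → ℤ) → ℂ := fun n σ k => c * truncate n U σ k with hf
  have hfm : ∀ n k, Measurable fun σ => f n σ k := fun n k => (measurable_truncate n (hU k)).const_mul c
  have hfi : ∀ n k, Integrable fun σ => f n σ k := fun n k =>
    (integrable_truncate n (hU k) (ENNReal.ne_top_of_tsum_ne_top hU2 k)).const_mul c
  have hf0 : ∀ n, ∀ k ∉ frequencyBox n, ∀ σ, f n σ k = 0 := fun n k hk σ => by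
    rw [hf]; simp only [truncate_eq_zero n U hk, mul_zero]
  have hcle : ∀ z : ℂ, ‖c * z‖ ≤ ‖z‖ := fun z => by
    rw [norm_mul]; exact mul_le_of_le_one_left (norm_nonneg _) hcn
  have hfn : ∀ n σ k, ‖f n σ k‖ ≤ ‖U σ k‖ := fun n σ k =>
    (hcle _).trans (norm_truncate_le n U σ k)
  set w : ℕ → ℝ × Torus2 → ℂ := fun n => spaceTimeWave (frequencyBox n) (f n) with hw
  have hwc : ∀ n, Continuous (w n) := fun n => continuous_spaceTimeWave _ (hfi n)
  have hdiff : ∀ N n m, N ≤ n → N ≤ m → ∫⁻ p, ‖w n p - w m p‖ₑ ^ 2 ≤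
      ENNReal.ofReal ((2 * Real.pi) ^ 3) * truncationTail N U := by
    intro N n m hn hm
    have hsub : ∀ p, w n p - w m p = spaceTimeWave (frequencyBox n ∪ frequencyBox m)
        (fun σ k => f n σ k - f m σ k) p := fun p => by
      rw [spaceTimeWave_sub _ (hfi n) (hfi m), hw]
      simp only
      rw [spaceTimeWave_eq_of_subset Finset.subset_union_left (hf0 n),
        spaceTimeWave_eq_of_subset Finset.subset_union_right (hf0 m)]
    simp only [hsub]
    refine (lintegral_spaceTimeWave_sq_le _ fun k => (hfi n k).sub (hfi m k)).trans ?_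
    gcongr
    refine (ENNReal.sum_le_tsum _).trans ?_
    unfold truncationTail
    gcongr with k σ
    refine enorm_le_iff_norm_le.2 ?_
    change ‖c * truncate n U σ k - c * truncate m U σ k‖ ≤ _
    rw [← mul_sub]
    exact (hcle _).trans (norm_truncate_sub_truncate_le hn hm U σ k)
  have hwL : ∀ n, MemLp (w n) 2 := fun n => by
    refine memLp_two_of_lintegral_sq_ne_top (hwc n).aestronglyMeasurable ?_
    have hle : ∫⁻ p, ‖w n p‖ₑ ^ 2
        ≤ ENNReal.ofReal ((2 * Real.pi) ^ 3) * ∑' k, ∫⁻ σ, ‖U σ k‖ₑ ^ 2 := by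
      refine (lintegral_spaceTimeWave_sq_le (frequencyBox n) (hfi n)).trans ?_
      gcongr
      refine (ENNReal.sum_le_tsum _).trans ?_
      gcongr with k σ
      exact enorm_le_iff_norm_le.2 (hfn n σ k)
    exact ne_top_of_le_ne_top (ENNReal.mul_ne_top ENNReal.ofReal_ne_top hU2) hle
  have hcauchy : CauchySeq fun n => (hwL n).toLp (w n) := by
    rw [EMetric.cauchySeq_iff_le_tendsto_0]
    refine ⟨fun N => (ENNReal.ofReal ((2 * Real.pi) ^ 3) * truncationTail N U) ^ (1 / 2 : ℝ),
      fun n m N hn hm => ?_, ?_⟩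
    · rw [Lp.edist_toLp_toLp, eLpNorm_two_eq]
      exact ENNReal.rpow_le_rpow (hdiff N n m hn hm) (by norm_num)
    · have h1 := ENNReal.Tendsto.const_mul (tendsto_truncationTail hU hU2)
        (Or.inr (ENNReal.ofReal_ne_top (r := (2 * Real.pi) ^ 3)))
      have h2 := (ENNReal.continuous_rpow_const (y := 1 / 2)).tendsto _ |>.comp h1
      simpa [Function.comp_def] using h2
  obtain ⟨v, hv⟩ := cauchySeq_tendsto_of_complete hcauchy
  have hvt : Filter.Tendsto (fun n => eLpNorm (w n - (v : ℝ × Torus2 → ℂ)) 2 volume) Filter.atTop (𝓝 0) := by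
    have := tendsto_iff_edist_tendsto_0.1 hv
    refine this.congr fun n => ?_
    rw [Lp.edist_def]
    exact eLpNorm_congr_ae (((hwL n).coeFn_toLp).sub (Filter.EventuallyEq.refl _ _))
  have huv : u =ᵐ[volume] v := by
    have hψ2 : ∀ ψ : 𝓢(ℝ, ℂ), MemLp (fun p : ℝ × Torus2 => ψ p.1) 2 := fun ψ =>
      (ψ.memLp 2 volume).comp_fst volume
    refine ae_eq_of_integral_timeFourier_eq h.integrable_left
      (fun ψ => (hψ2 ψ).integrable_mul (Lp.memLp v)) fun k ψ => ?_
    rw [h.integral_eq]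
    obtain ⟨φ, hφ⟩ := exists_schwartz_eq_timeFourier ψ
    set G : ℝ × Torus2 → ℂ := fun p => φ p.1 * torusChar k p.2 with hG
    have hGc : Continuous G := by
      have := φ.continuous
      fun_prop
    have hG2 : MemLp G 2 := (hψ2 φ).of_le hGc.aestronglyMeasurable
      (Filter.Eventually.of_forall fun p => by rw [hG]; simp [norm_torusChar])
    have hlim₁ : Filter.Tendsto (fun n => ∫ p, G p * w n p) Filter.atTop (𝓝 (∫ p, G p * v p)) := by
      refine tendsto_integral_of_L1' _ (hG2.integrable_mul (Lp.memLp v)).1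
        (Filter.Eventually.of_forall fun n => hG2.integrable_mul (hwL n)) ?_
      have h0 := ENNReal.Tendsto.const_mul hvt (Or.inr hG2.eLpNorm_lt_top.ne)
      rw [mul_zero] at h0
      refine tendsto_of_tendsto_of_tendsto_of_le_of_le tendsto_const_nhds h0
        (fun n => zero_le) fun n => ?_
      have hsm : (fun p => G p * w n p) - (G * (v : ℝ × Torus2 → ℂ)) = G • (w n - (v : ℝ × Torus2 → ℂ)) := by
        funext p; simp [mul_sub]
      rw [hsm]
      exact eLpNorm_smul_le_mul_eLpNorm
        ((hwL n).1.sub (Lp.aestronglyMeasurable v)) hGc.aestronglyMeasurable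
    -- Once the box contains `k`, the pairing with the `n`-th wave is exactly the pairing of `ψ`
    -- with the truncation of `U`.
    have hlim₂ : Filter.Tendsto (fun n => ∫ p, G p * w n p) Filter.atTop (𝓝 (∫ σ, ψ σ * U σ k)) := by
      have h1 : Filter.Tendsto (fun n => ∫ σ, ψ σ * truncate n U σ k) Filter.atTop
          (𝓝 (∫ σ, ψ σ * U σ k)) := by
        refine tendsto_integral_of_dominated_convergence (fun σ => ‖ψ σ * U σ k‖) (fun n => ?_)
          (h.integrable_right k ψ).norm (fun n => Filter.Eventually.of_forall fun σ => ?_)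
          (Filter.Eventually.of_forall fun σ => ?_)
        · exact ψ.continuous.aestronglyMeasurable.mul
            (measurable_truncate n (hU k)).aestronglyMeasurable
        · rw [norm_mul, norm_mul]
          gcongr
          exact norm_truncate_le n U σ k
        · refine tendsto_const_nhds.congr' ?_
          filter_upwards [eventually_truncate_eq U σ k] with n hn
          rw [hn]
      refine h1.congr' ?_
      obtain ⟨n₀, hn₀⟩ := exists_mem_frequencyBox k
      filter_upwards [Filter.eventually_ge_atTop n₀] with n hn
      have h2 := integral_timeFourier_mul_spaceTimeWave (hn₀ n hn) (hfi n) ψ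
      calc ∫ σ, ψ σ * truncate n U σ k
          = (2 * Real.pi) ^ 3 * ∫ σ, ψ σ * f n σ k := by
            rw [hf]
            simp only [mul_left_comm _ c, integral_const_mul]
            rw [← mul_assoc, mul_comm c, hc1, one_mul]
        _ = _ := by
            rw [← h2]
            refine integral_congr_ae (Filter.Eventually.of_forall fun p => ?_)
            simp only [hG, hφ, hw]
            ring
    rw [tendsto_nhds_unique hlim₂ hlim₁]
    refine integral_congr_ae (Filter.Eventually.of_forall fun p => ?_)
    simp only [hG, hφ]
    ring
  refine ⟨(Lp.memLp v).ae_eq huv.symm, ?_⟩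
  obtain ⟨ns, -, hns⟩ := (tendstoInMeasure_of_tendsto_eLpNorm (by norm_num)
    (fun n => (hwc n).aestronglyMeasurable) (Lp.aestronglyMeasurable v) hvt).exists_seq_tendsto_ae
  refine ⟨fun n => frequencyBox (ns n), fun n => f (ns n), fun n => hfm _, fun n => hfi _,
    fun n => hf0 _, fun n => hfn _, ?_⟩
  filter_upwards [hns, huv] with p hp hup
  rw [hup]
  exact hp

end Approximation

/-! ### The bilinear estimate for general functions -/

section Bilinear

open scoped ENNReal Topology

theorem weightedEnergy_mono_norm (s b : ℝ) {f g : ℝ → (Fin 2 → ℤ) → ℂ}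
    (h : ∀ σ k, ‖f σ k‖ ≤ ‖g σ k‖) : weightedEnergy s b f ≤ weightedEnergy s b g := by
  unfold weightedEnergy
  gcongr with k σ
  exact enorm_le_iff_norm_le.2 (h σ k)

theorem weightedEnergy_mono_exponent (s : ℝ) {b b' : ℝ} (h : b ≤ b') (f : ℝ → (Fin 2 → ℤ) → ℂ) :
    weightedEnergy s b f ≤ weightedEnergy s b' f := by
  unfold weightedEnergy
  gcongr with k σ
  unfold bourgainWeight
  gcongr
  exact one_le_sqrt_one_add_sq _

theorem lintegral_sq_le_weightedEnergy {s b : ℝ} (hs : 0 ≤ s) (hb : 0 ≤ b)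
    (f : ℝ → (Fin 2 → ℤ) → ℂ) : ∑' k, ∫⁻ σ, ‖f σ k‖ₑ ^ 2 ≤ weightedEnergy s b f := by
  unfold weightedEnergy
  gcongr with k σ
  refine le_mul_of_one_le_left' (ENNReal.one_le_ofReal.2 ?_)
  exact one_le_mul_of_one_le_of_one_le (Real.one_le_rpow (one_le_sqrt_freqSq k) hs)
    (Real.one_le_rpow (one_le_sqrt_one_add_sq _) hb)

/-- The bilinear estimate `‖uv‖_{L²} ≲ ‖u‖_{X^{s,b}} ‖v‖_{X^{0,b}}`. -/
theorem exists_lintegral_mul_sq_le {s b : ℝ} (hs : 0 < s) (hb : 1 / 4 < b)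
    (hb' : b < 1 / 2) (hsb : 1 / 2 - s / 4 < b) :
    ∃ C : ℝ≥0∞, C ≠ ∞ ∧ ∀ (u v : ℝ × Torus2 → ℂ) (U V : ℝ → (Fin 2 → ℤ) → ℂ),
      IsWaveLimit u U → IsWaveLimit v V →
      ∫⁻ p, ‖u p * v p‖ₑ ^ 2 ≤ C * weightedEnergy s b U * weightedEnergy 0 b V := by
  obtain ⟨C, hC, h⟩ := exists_lintegral_spaceTimeWave_mul_sq_le hs hb hb' hsb
  refine ⟨C, hC, fun u v U V => ?_⟩
  rintro ⟨S, f, hfm, hfi, -, hfU, hfu⟩ ⟨T, g, hgm, hgi, hg0, hgV, hgv⟩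
  -- Fatou's lemma: the approximating products converge almost everywhere, and their bounds are
  -- uniform in `n` because the data are dominated by `U` and `V`.
  calc ∫⁻ p, ‖u p * v p‖ₑ ^ 2
      = ∫⁻ p, Filter.liminf (fun n => ‖spaceTimeWave (S n) (f n) p * spaceTimeWave (T n) (g n) p‖ₑ ^ 2)
          Filter.atTop := by
        refine lintegral_congr_ae ?_
        filter_upwards [hfu, hgv] with p hp hq
        have h2 := ((continuous_enorm.tendsto _).comp (hp.mul hq))
        exact (((ENNReal.continuous_pow 2).tendsto _).comp h2).liminf_eq.symm
    _ ≤ Filter.liminf (fun n => ∫⁻ p, ‖spaceTimeWave (S n) (f n) p *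
          spaceTimeWave (T n) (g n) p‖ₑ ^ 2) Filter.atTop := by
        refine lintegral_liminf_le fun n => ?_
        have h1 := continuous_spaceTimeWave (S n) (hfi n)
        have h2 := continuous_spaceTimeWave (T n) (hgi n)
        exact (h1.mul h2).measurable.enorm.pow_const 2
    _ ≤ C * weightedEnergy s b U * weightedEnergy 0 b V := by
        refine Filter.liminf_le_of_frequently_le' (Filter.Frequently.of_forall fun n => ?_)
        refine (h (S n) (T n) (f n) (g n) (hfm n) (hgm n) (hfi n) (hgi n) (hg0 n)).trans ?_
        gcongr
        · exact weightedEnergy_mono_norm s b (hfU n)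
        · exact weightedEnergy_mono_norm 0 b (hgV n)

theorem isWaveLimit_spaceTimeWave {S : Finset (Fin 2 → ℤ)} {g : ℝ → (Fin 2 → ℤ) → ℂ}
    (hgm : ∀ k, Measurable fun σ => g σ k) (hgi : ∀ k, Integrable fun σ => g σ k)
    (hg0 : ∀ k ∉ S, ∀ σ, g σ k = 0) : IsWaveLimit (spaceTimeWave S g) g :=
  ⟨fun _ => S, fun _ => g, fun _ => hgm, fun _ => hgi, fun _ => hg0, fun _ _ _ => le_rfl,
    Filter.Eventually.of_forall fun _ => tendsto_const_nhds⟩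

end Bilinear

/-! ### Transforms of integrable functions and duality -/

section FourierIntegral

open scoped ENNReal Topology SchwartzMap

/-- The space-time Fourier transform of an integrable function. -/
noncomputable def spaceTimeFourierIntegral (w : ℝ × Torus2 → ℂ) (σ : ℝ) (k : Fin 2 → ℤ) : ℂ :=
  ∫ p : ℝ × Torus2, Complex.exp (-Complex.I * σ * p.1) * (w p * torusChar k p.2)

theorem norm_exp_neg_I_mul (σ t : ℝ) : ‖Complex.exp (-Complex.I * σ * t)‖ = 1 := by
  rw [show -Complex.I * σ * t = ((-(σ * t) : ℝ) : ℂ) * Complex.I by push_cast; ring,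
    Complex.norm_exp_ofReal_mul_I]

theorem continuous_spaceTimeFourierIntegral {w : ℝ × Torus2 → ℂ} (hw : Integrable w)
    (k : Fin 2 → ℤ) : Continuous fun σ => spaceTimeFourierIntegral w σ k := by
  refine continuous_of_dominated (bound := fun p => ‖w p‖) (fun σ => ?_) (fun σ => ?_) hw.norm ?_
  · exact (Continuous.aestronglyMeasurable (by fun_prop)).mul (integrable_mul_torusChar hw k).1
  · refine Filter.Eventually.of_forall fun p => ?_
    rw [norm_mul, norm_exp_neg_I_mul, norm_mul, norm_torusChar, one_mul, mul_one]
  · exact Filter.Eventually.of_forall fun p => by fun_prop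

theorem norm_spaceTimeFourierIntegral_le (w : ℝ × Torus2 → ℂ) (σ : ℝ) (k : Fin 2 → ℤ) :
    ‖spaceTimeFourierIntegral w σ k‖ ≤ ∫ p, ‖w p‖ := by
  refine (norm_integral_le_integral_norm _).trans (le_of_eq ?_)
  simp only [norm_mul, norm_exp_neg_I_mul, norm_torusChar, one_mul, mul_one]

/-- The multiplication formula for the space-time Fourier transform. -/
theorem integral_mul_spaceTimeFourierIntegral {w : ℝ × Torus2 → ℂ} (hw : Integrable w)
    {a : ℝ → ℂ} (ha : Integrable a) (k : Fin 2 → ℤ) :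
    ∫ σ, a σ * spaceTimeFourierIntegral w σ k =
      ∫ p : ℝ × Torus2, (∫ σ : ℝ, a σ * Complex.exp (-Complex.I * σ * p.1)) *
        (w p * torusChar k p.2) := by
  have hint : Integrable (Function.uncurry fun (σ : ℝ) (p : ℝ × Torus2) =>
      a σ * (Complex.exp (-Complex.I * σ * p.1) * (w p * torusChar k p.2))) (volume.prod volume) := by
    refine ((ha.mul_prod (integrable_mul_torusChar hw k)).bdd_mul (c := 1)
      (f := fun q : ℝ × ℝ × Torus2 => Complex.exp (-Complex.I * q.1 * q.2.1))
      (Continuous.aestronglyMeasurable (by fun_prop))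
      (Filter.Eventually.of_forall fun q => (norm_exp_neg_I_mul _ _).le)).congr
      (Filter.Eventually.of_forall fun q => ?_)
    simp only [Function.uncurry]
    ring
  unfold spaceTimeFourierIntegral
  simp only [← integral_const_mul]
  rw [integral_integral_swap hint]
  refine integral_congr_ae (Filter.Eventually.of_forall fun p => ?_)
  simp only [← integral_mul_const]
  refine integral_congr_ae (Filter.Eventually.of_forall fun σ => ?_)
  simp only [mul_assoc]

theorem isSpaceTimeFourier_of_integrable {w : ℝ × Torus2 → ℂ} (hw : Integrable w) :
    IsSpaceTimeFourier w (spaceTimeFourierIntegral w) where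
  integrable_left ψ := by
    refine hw.bdd_mul (c := ‖ψ.toBoundedContinuousFunction‖)
      (ψ.continuous.comp continuous_fst).aestronglyMeasurable
      (Filter.Eventually.of_forall fun p => ψ.toBoundedContinuousFunction.norm_coe_le_norm p.1)
  integrable_right k ψ :=
    ψ.integrable.mul_bdd (continuous_spaceTimeFourierIntegral hw k).aestronglyMeasurable
      (Filter.Eventually.of_forall fun σ => norm_spaceTimeFourierIntegral_le w σ k)
  integral_eq k ψ := (integral_mul_spaceTimeFourierIntegral hw ψ.integrable k).symm

theorem conj_timeWave (g : ℝ → ℂ) (t : ℝ) : (starRingEnd ℂ) (timeWave g t) =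
    ∫ σ : ℝ, (starRingEnd ℂ) (g σ) * Complex.exp (-Complex.I * σ * t) := by
  rw [timeWave, ← integral_conj]
  refine integral_congr_ae (Filter.Eventually.of_forall fun σ => ?_)
  simp only [map_mul, ← Complex.exp_conj, Complex.conj_I, Complex.conj_ofReal]

/-- The unnormalized wave sum is the adjoint of the Fourier integral, so no power of `2π` appears.
-/
theorem sum_integral_conj_mul_spaceTimeFourierIntegral {w : ℝ × Torus2 → ℂ} (hw : Integrable w)
    (S : Finset (Fin 2 → ℤ)) {g : ℝ → (Fin 2 → ℤ) → ℂ} (hg : ∀ k, Integrable fun σ => g σ k) :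
    ∑ k ∈ S, ∫ σ, (starRingEnd ℂ) (g σ k) * spaceTimeFourierIntegral w σ k =
      ∫ p, w p * (starRingEnd ℂ) (spaceTimeWave S g p) := by
  have hgc : ∀ k, Integrable fun σ => (starRingEnd ℂ) (g σ k) := fun k =>
    (hg k).mono (Complex.continuous_conj.comp_aestronglyMeasurable (hg k).1)
      (Filter.Eventually.of_forall fun σ => by simp)
  simp only [integral_mul_spaceTimeFourierIntegral hw (hgc _), ← conj_timeWave]
  rw [← integral_finsetSum]
  · refine integral_congr_ae (Filter.Eventually.of_forall fun p => ?_)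
    simp only [spaceTimeWave, map_sum, map_mul, Finset.mul_sum]
    refine Finset.sum_congr rfl fun k _ => ?_
    rw [← torusChar_neg, neg_neg]
    ring
  · intro k _
    refine (integrable_mul_torusChar hw k).bdd_mul (c := ∫ σ, ‖g σ k‖) ?_
      (Filter.Eventually.of_forall fun p => ?_)
    · exact (Complex.continuous_conj.comp ((continuous_timeWave (hg k)).comp
        continuous_fst)).aestronglyMeasurable
    · rw [RCLike.norm_conj]
      exact norm_timeWave_le _ _

theorem bourgainWeight_zero_neg (b σ : ℝ) (k : Fin 2 → ℤ) :
    bourgainWeight 0 (-b) σ k = (bourgainWeight 0 b σ k)⁻¹ := by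
  unfold bourgainWeight
  rw [Real.rpow_neg (Real.sqrt_nonneg _), Real.rpow_zero, one_mul, one_mul]

theorem ENNReal.tsum_liminf_le {ι : Type*} (f : ℕ → ι → ℝ≥0∞) :
    ∑' i, Filter.liminf (fun n => f n i) Filter.atTop
      ≤ Filter.liminf (fun n => ∑' i, f n i) Filter.atTop := by
  let _ : MeasurableSpace ι := ⊤
  have := lintegral_liminf_le (u := Filter.atTop) (μ := (Measure.count : Measure ι)) (f := f)
    (fun n => measurable_from_top)
  simpa only [lintegral_count] using this

theorem weightedEnergy_le_liminf_truncate (s b : ℝ) {W : ℝ → (Fin 2 → ℤ) → ℂ}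
    (hW : ∀ k, Measurable fun σ => W σ k) :
    weightedEnergy s b W ≤
      Filter.liminf (fun n => weightedEnergy s b (truncate n W)) Filter.atTop := by
  refine le_trans ?_ (ENNReal.tsum_liminf_le _)
  unfold weightedEnergy
  refine ENNReal.tsum_le_tsum fun k => ?_
  have hm : ∀ n, Measurable fun σ =>
      (ENNReal.ofReal (bourgainWeight s b σ k) * ‖truncate n W σ k‖ₑ) ^ 2 := fun n =>
    ((continuous_bourgainWeight s b k).measurable.ennreal_ofReal.mul
      (measurable_truncate n (hW k)).enorm).pow_const 2
  refine le_trans (le_of_eq ?_) (lintegral_liminf_le hm)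
  refine lintegral_congr fun σ => (Filter.Tendsto.liminf_eq ?_).symm
  refine tendsto_const_nhds.congr' ?_
  filter_upwards [eventually_truncate_eq W σ k] with n hn
  rw [hn]

/-- Cancelling `A ^ (1/2)` requires it to be finite, which is why the duality argument works with
truncations. -/
theorem ENNReal.le_sq_of_le_mul_rpow_half {A M : ℝ≥0∞} (hA : A ≠ ∞) (h : A ≤ M * A ^ (1 / 2 : ℝ)) :
    A ≤ M ^ 2 := by
  rcases eq_or_ne A 0 with rfl | h0
  · exact zero_le
  set r := A ^ (1 / 2 : ℝ) with hr
  have hrr : r ^ 2 = A := by rw [hr, ← ENNReal.rpow_natCast, ← ENNReal.rpow_mul]; norm_num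
  have hr0 : r ≠ 0 := by rintro h'; rw [h'] at hrr; exact h0 (by simpa using hrr.symm)
  have hrt : r ≠ ∞ := by rintro h'; rw [h'] at hrr; exact hA (by simpa using hrr.symm)
  rw [← hrr] at h ⊢
  gcongr
  rw [sq] at h
  exact (ENNReal.mul_le_mul_iff_left hr0 hrt).1 h

/-- Duality between `X^{0,b}` and `X^{0,-b}`. -/
theorem weightedEnergy_spaceTimeFourierIntegral_le {w : ℝ × Torus2 → ℂ} (hw : Integrable w) {b : ℝ}
    {M : ℝ≥0∞} (hM : ∀ (S : Finset (Fin 2 → ℤ)) (g : ℝ → (Fin 2 → ℤ) → ℂ),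
      (∀ k, Measurable fun σ => g σ k) → (∀ k, Integrable fun σ => g σ k) →
      (∀ k ∉ S, ∀ σ, g σ k = 0) →
      ∫⁻ p, ‖w p‖ₑ * ‖spaceTimeWave S g p‖ₑ ≤ M * weightedEnergy 0 b g ^ (1 / 2 : ℝ)) :
    weightedEnergy 0 (-b) (spaceTimeFourierIntegral w) ≤ M ^ 2 := by
  set W := spaceTimeFourierIntegral w with hW
  have hWc : ∀ k, Continuous fun σ => W σ k := continuous_spaceTimeFourierIntegral hw
  -- By Fatou it suffices to bound the truncated energies, which are finite.
  refine (weightedEnergy_le_liminf_truncate 0 (-b) fun k => (hWc k).measurable).trans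
    (Filter.liminf_le_of_frequently_le' (Filter.Frequently.of_forall fun n => ?_))
  set ω : ℝ → (Fin 2 → ℤ) → ℝ := fun σ k => (bourgainWeight 0 b σ k)⁻¹ with hω
  have hωpos : ∀ σ k, 0 < ω σ k := fun σ k => inv_pos.2 (bourgainWeight_pos 0 b σ k)
  have hωc : ∀ k, Continuous fun σ => ω σ k := fun k =>
    (continuous_bourgainWeight 0 b k).inv₀ fun σ => (bourgainWeight_pos 0 b σ k).ne'
  -- The extremal test function: after truncation, its `X^{0,b}` energy and its pairing with `W`
  -- both equal the truncated `X^{0,-b}` energy of `W`.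
  set G : ℝ → (Fin 2 → ℤ) → ℂ := fun σ k => ((ω σ k ^ 2 : ℝ) : ℂ) * W σ k with hG
  have hGc : ∀ k, Continuous fun σ => G σ k := fun k =>
    (Complex.continuous_ofReal.comp ((hωc k).pow 2)).mul (hWc k)
  have hti : ∀ {H : ℝ → (Fin 2 → ℤ) → ℂ}, (∀ k, Continuous fun σ => H σ k) → ∀ k,
      Integrable fun σ => truncate n H σ k := fun {H} hH k => by
    by_cases hk : k ∈ frequencyBox n
    · rw [truncate_eq_indicator n H hk, integrable_indicator_iff measurableSet_Icc]
      exact (hH k).continuousOn.integrableOn_compact isCompact_Icc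
    · simp only [truncate_eq_zero n H hk]
      exact integrable_zero _ _ _
  set g := truncate n G with hg
  have hgm : ∀ k, Measurable fun σ => g σ k := fun k => measurable_truncate n (hGc k).measurable
  have htr : ∀ σ k, g σ k = ((ω σ k ^ 2 : ℝ) : ℂ) * truncate n W σ k := fun σ k => by
    rw [hg]; unfold truncate; split_ifs <;> simp [hG]
  have hterm : ∀ σ k, (ENNReal.ofReal (bourgainWeight 0 (-b) σ k) * ‖truncate n W σ k‖ₑ) ^ 2
      = ENNReal.ofReal ((ω σ k * ‖truncate n W σ k‖) ^ 2) := fun σ k => by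
    rw [bourgainWeight_zero_neg, ENNReal.ofReal_pow (by have := hωpos σ k; positivity),
      ENNReal.ofReal_mul (hωpos σ k).le, ofReal_norm]
  have hEg : weightedEnergy 0 b g = weightedEnergy 0 (-b) (truncate n W) := by
    unfold weightedEnergy
    refine tsum_congr fun k => lintegral_congr fun σ => ?_
    have h1 := bourgainWeight_pos 0 b σ k
    rw [hterm, htr, ← ofReal_norm, ← ENNReal.ofReal_mul h1.le, ← ENNReal.ofReal_pow (by positivity),
      norm_mul, Complex.norm_real, Real.norm_of_nonneg (by positivity)]
    congr 2
    rw [← mul_assoc, hω]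
    field_simp
  have hci : ∀ k, Integrable fun σ => (ω σ k * ‖truncate n W σ k‖) ^ 2 := fun k => by
    have hH : ∀ k, Continuous fun σ => (((ω σ k * ‖W σ k‖) ^ 2 : ℝ) : ℂ) := fun k =>
      Complex.continuous_ofReal.comp (((hωc k).mul (hWc k).norm).pow 2)
    refine (hti (H := fun σ k => (((ω σ k * ‖W σ k‖) ^ 2 : ℝ) : ℂ)) hH k).norm.congr
      (Filter.Eventually.of_forall fun σ => ?_)
    simp only [truncate]
    split_ifs
    · rw [Complex.norm_real, Real.norm_of_nonneg (by positivity)]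
    · simp
  have hsum : weightedEnergy 0 (-b) (truncate n W) =
      ∑ k ∈ frequencyBox n, ENNReal.ofReal (∫ σ, (ω σ k * ‖truncate n W σ k‖) ^ 2) := by
    unfold weightedEnergy
    rw [tsum_eq_sum fun k hk => by simp [truncate_eq_zero n W hk]]
    refine Finset.sum_congr rfl fun k _ => ?_
    rw [ofReal_integral_eq_lintegral_ofReal (hci k)
      (Filter.Eventually.of_forall fun σ => by positivity)]
    exact lintegral_congr fun σ => hterm σ k
  refine ENNReal.le_sq_of_le_mul_rpow_half ?_ ?_
  · rw [hsum]
    exact ENNReal.sum_ne_top.2 fun k _ => ENNReal.ofReal_ne_top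
  have hpair := sum_integral_conj_mul_spaceTimeFourierIntegral hw (frequencyBox n) (hti hGc)
  have hreal : ∀ k, ∫ σ, (starRingEnd ℂ) (truncate n G σ k) * spaceTimeFourierIntegral w σ k
      = ((∫ σ, (ω σ k * ‖truncate n W σ k‖) ^ 2 : ℝ) : ℂ) := fun k => by
    rw [← integral_complex_ofReal]
    refine integral_congr_ae (Filter.Eventually.of_forall fun σ => ?_)
    simp only [← hg, ← hW, htr, map_mul, Complex.conj_ofReal]
    have : (starRingEnd ℂ) (truncate n W σ k) * W σ k = ((‖truncate n W σ k‖ ^ 2 : ℝ) : ℂ) := by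
      unfold truncate
      split_ifs
      · rw [Complex.conj_mul']; push_cast; rfl
      · simp
    rw [mul_assoc, this]
    push_cast
    ring
  simp only [hreal, ← Complex.ofReal_sum] at hpair
  calc weightedEnergy 0 (-b) (truncate n W)
      = ‖((∑ k ∈ frequencyBox n, ∫ σ, (ω σ k * ‖truncate n W σ k‖) ^ 2 : ℝ) : ℂ)‖ₑ := by
        have h0 : ∀ k, 0 ≤ ∫ σ, (ω σ k * ‖truncate n W σ k‖) ^ 2 := fun k =>
          integral_nonneg fun σ => by positivity
        rw [hsum, ← ofReal_norm, Complex.norm_real,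
          Real.norm_of_nonneg (Finset.sum_nonneg fun k _ => h0 k),
          ENNReal.ofReal_sum_of_nonneg fun k _ => h0 k]
    _ ≤ ∫⁻ p, ‖w p‖ₑ * ‖spaceTimeWave (frequencyBox n) g p‖ₑ := by
        rw [hpair]
        refine (enorm_integral_le_lintegral_enorm _).trans (le_of_eq (lintegral_congr fun p => ?_))
        rw [enorm_mul, ← ofReal_norm ((starRingEnd ℂ) _), RCLike.norm_conj, ofReal_norm]
    _ ≤ M * weightedEnergy 0 (-b) (truncate n W) ^ (1 / 2 : ℝ) := by
        rw [← hEg]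
        exact hM _ g hgm (hti hGc) fun k hk σ => truncate_eq_zero n G hk σ

end FourierIntegral

/-! ### The trilinear estimate -/

section Trilinear

open scoped ENNReal Topology

/-- The trilinear estimate on the Fourier side, for the space-time Fourier integral of a product `w`
of modulus `|x y z|`. -/
theorem exists_weightedL2Norm_product_le {s b : ℝ} (hs : 0 < s) (hb : 1 / 4 < b) (hb' : b < 1 / 2)
    (hsb : 1 / 2 - s / 4 < b) :
    ∃ C : ℝ≥0∞, C ≠ ∞ ∧ ∀ (w x y z : ℝ × Torus2 → ℂ) (X Y Z : ℝ → (Fin 2 → ℤ) → ℂ),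
      AEStronglyMeasurable w → (∀ p, ‖w p‖ₑ = ‖x p‖ₑ * ‖y p‖ₑ * ‖z p‖ₑ) →
      MemLp x 2 → MemLp y 2 → MemLp z 2 → IsWaveLimit x X → IsWaveLimit y Y → IsWaveLimit z Z →
      weightedEnergy s b X ≠ ∞ → weightedEnergy 0 b Z ≠ ∞ →
      Integrable w ∧ weightedL2Norm 0 (-b) (spaceTimeFourierIntegral w) ≤
        C * weightedL2Norm s b X * weightedL2Norm s b Y * weightedL2Norm 0 b Z := by
  obtain ⟨C, hC, h⟩ := exists_lintegral_mul_sq_le hs hb hb' hsb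
  refine ⟨C, hC, fun w x y z X Y Z hw hwn hx hy hz hX hY hZ hXf hZf => ?_⟩
  -- The grouping `(x z)(y F)` places one factor from `X^{s,b}` in each pair. Taking `F = 1` gives
  -- integrability of `w`, since `y` is in `L²`; taking `F` to be the modulus of a wave gives the
  -- dual bound.
  have hcs : ∀ F : ℝ × Torus2 → ℝ≥0∞, AEMeasurable F →
      ∫⁻ p, ‖w p‖ₑ * F p ≤ (C * weightedEnergy s b X * weightedEnergy 0 b Z) ^ (1 / 2 : ℝ) *
        (∫⁻ p, (‖y p‖ₑ * F p) ^ 2) ^ (1 / 2 : ℝ) := by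
    intro F hF
    have h1 := ENNReal.lintegral_mul_le_Lp_mul_Lq volume Real.HolderConjugate.two_two
      (f := fun p => ‖x p * z p‖ₑ) (g := fun p => ‖y p‖ₑ * F p)
      (hx.1.mul hz.1).enorm (hy.1.enorm.mul hF)
    simp only [Pi.mul_apply, ENNReal.rpow_ofNat] at h1
    calc ∫⁻ p, ‖w p‖ₑ * F p = ∫⁻ p, ‖x p * z p‖ₑ * (‖y p‖ₑ * F p) :=
          lintegral_congr fun p => by rw [hwn, enorm_mul]; ring
      _ ≤ _ := h1.trans (by gcongr; exact h x z X Z hX hZ)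
  have hwint : Integrable w := by
    refine ⟨hw, ?_⟩
    have h1 := hcs (fun _ => 1) aemeasurable_const
    simp only [mul_one] at h1
    refine lt_of_le_of_lt h1 (ENNReal.mul_lt_top ?_ ?_)
    · exact ENNReal.rpow_lt_top_of_nonneg (by norm_num)
        (ENNReal.mul_ne_top (ENNReal.mul_ne_top hC hXf) hZf)
    · rw [← eLpNorm_two_eq]
      exact hy.2
  refine ⟨hwint, ?_⟩
  set M : ℝ≥0∞ := C * weightedL2Norm s b X * weightedL2Norm s b Y * weightedL2Norm 0 b Z with hM
  have hE := weightedEnergy_spaceTimeFourierIntegral_le hwint (b := b) (M := M)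
    fun S g hgm hgi hg0 => by
      have h1 := hcs (fun p => ‖spaceTimeWave S g p‖ₑ)
        (continuous_spaceTimeWave S hgi).measurable.enorm.aemeasurable
      simp only [← enorm_mul] at h1
      simp only [← enorm_mul]
      have hC2 : C ^ (1 / 2 : ℝ) * C ^ (1 / 2 : ℝ) = C := by
        rw [← ENNReal.rpow_add_of_nonneg _ _ (by norm_num) (by norm_num)]; norm_num
      calc _ ≤ (C * weightedEnergy s b X * weightedEnergy 0 b Z) ^ (1 / 2 : ℝ) *
            (C * weightedEnergy s b Y * weightedEnergy 0 b g) ^ (1 / 2 : ℝ) := by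
            refine h1.trans ?_
            gcongr
            exact h y _ Y g hY (isWaveLimit_spaceTimeWave hgm hgi hg0)
        _ = (C ^ (1 / 2 : ℝ) * C ^ (1 / 2 : ℝ)) * weightedL2Norm s b X * weightedL2Norm s b Y *
            weightedL2Norm 0 b Z * weightedEnergy 0 b g ^ (1 / 2 : ℝ) := by
            simp only [weightedL2Norm_eq]
            rw [ENNReal.mul_rpow_of_nonneg _ _ (by norm_num), ENNReal.mul_rpow_of_nonneg _ _ (by norm_num),
              ENNReal.mul_rpow_of_nonneg _ _ (by norm_num), ENNReal.mul_rpow_of_nonneg _ _ (by norm_num)]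
            ring
        _ = M * weightedEnergy 0 b g ^ (1 / 2 : ℝ) := by rw [hC2]
  calc weightedL2Norm 0 (-b) (spaceTimeFourierIntegral w) ≤ (M ^ 2) ^ (1 / 2 : ℝ) := by
        rw [weightedL2Norm_eq]
        gcongr
    _ = M := by rw [← ENNReal.rpow_natCast, ← ENNReal.rpow_mul]; norm_num

theorem weightedL2Norm_mono_exponent (s : ℝ) {b b' : ℝ} (h : b ≤ b') (f : ℝ → (Fin 2 → ℤ) → ℂ) :
    weightedL2Norm s b f ≤ weightedL2Norm s b' f := by
  rw [weightedL2Norm_eq, weightedL2Norm_eq]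
  gcongr
  exact weightedEnergy_mono_exponent s h f

theorem bourgainNorm_mono_exponent (s : ℝ) {b b' : ℝ} (h : b ≤ b') (u : ℝ × Torus2 → ℂ) :
    bourgainNorm s b u ≤ bourgainNorm s b' u :=
  iInf₂_mono fun U _ => weightedL2Norm_mono_exponent s h U

/-- Data attaining the Bourgain norm up to a small error. -/
theorem exists_measurable_weightedL2Norm_lt {s b : ℝ} {u : ℝ × Torus2 → ℂ} {r : ℝ≥0∞}
    (h : bourgainNorm s b u < r) : ∃ U, IsSpaceTimeFourier u U ∧ (∀ k, Measurable fun σ => U σ k) ∧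
      weightedL2Norm s b U < r := by
  simp only [bourgainNorm, iInf_lt_iff] at h
  obtain ⟨U, hU, hr⟩ := h
  obtain ⟨U', hU', hm, he⟩ := hU.exists_measurable
  refine ⟨U', hU', hm, ?_⟩
  rwa [weightedL2Norm_eq, he, ← weightedL2Norm_eq]

theorem weightedEnergy_ne_top_of_weightedL2Norm_lt {s b : ℝ} {U : ℝ → (Fin 2 → ℤ) → ℂ} {r : ℝ≥0∞}
    (h : weightedL2Norm s b U < r) : weightedEnergy s b U ≠ ∞ := by
  rw [← weightedL2Norm_sq]
  exact ENNReal.pow_ne_top (h.trans_le le_top).ne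

theorem IsSpaceTimeFourier.memLp_isWaveLimit {s b : ℝ} (hs : 0 ≤ s) (hb : 0 ≤ b)
    {u : ℝ × Torus2 → ℂ} {U : ℝ → (Fin 2 → ℤ) → ℂ} (h : IsSpaceTimeFourier u U)
    (hU : ∀ k, Measurable fun σ => U σ k) (hE : weightedEnergy s b U ≠ ∞) :
    MemLp u 2 ∧ IsWaveLimit u U :=
  h.isWaveLimit hU (ne_top_of_le_ne_top hE (lintegral_sq_le_weightedEnergy hs hb U))

/-- The Bourgain norm is an infimum that is only approached by chosen data; the bound passes to the
limit because the product is continuous at finite arguments. -/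
theorem ENNReal.le_mul_of_forall_gt {B C a b c : ℝ≥0∞} (hC : C ≠ ∞) (ha : a ≠ ∞) (hb : b ≠ ∞)
    (hc : c ≠ ∞) (h : ∀ a' b' c', a < a' → b < b' → c < c' → B ≤ C * a' * b' * c') :
    B ≤ C * a * b * c := by
  have hlim : ∀ {x : ℝ≥0∞}, Filter.Tendsto (fun n : ℕ => x + (n : ℝ≥0∞)⁻¹) Filter.atTop (𝓝 x) :=
    fun {x} => by simpa using tendsto_const_nhds.add ENNReal.tendsto_inv_nat_nhds_zero
  have hlt : ∀ {x : ℝ≥0∞} (n : ℕ), x ≠ ∞ → x < x + (n : ℝ≥0∞)⁻¹ := fun {x} n hx =>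
    ENNReal.lt_add_right hx (ENNReal.inv_ne_zero.2 (ENNReal.natCast_ne_top n))
  have h1 := ENNReal.Tendsto.const_mul (hlim (x := a)) (Or.inr hC)
  have h2 := ENNReal.Tendsto.mul h1 (Or.inr hb) (hlim (x := b)) (Or.inr (ENNReal.mul_ne_top hC ha))
  have h3 := ENNReal.Tendsto.mul h2 (Or.inr hc) (hlim (x := c))
    (Or.inr (ENNReal.mul_ne_top (ENNReal.mul_ne_top hC ha) hb))
  exact ge_of_tendsto' h3 fun n => h _ _ _ (hlt n ha) (hlt n hb) (hlt n hc)

theorem exists_bourgainNorm_product_le {s b : ℝ} (hs : 0 < s) (hb : 1 / 4 < b) (hb' : b < 1 / 2)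
    (hsb : 1 / 2 - s / 4 < b) :
    ∃ C : ℝ≥0∞, C ≠ ∞ ∧ ∀ (σ : Equiv.Perm (Fin 3)) (u : Fin 3 → ℝ × Torus2 → ℂ),
      bourgainNorm s b (u (σ 0)) ≠ ∞ → bourgainNorm s b (u (σ 1)) ≠ ∞ →
      bourgainNorm 0 b (u (σ 2)) ≠ ∞ →
      bourgainNorm 0 (-b) (fun p => u 0 p * (starRingEnd ℂ) (u 1 p) * u 2 p) ≤
        C * bourgainNorm s b (u (σ 0)) * bourgainNorm s b (u (σ 1)) * bourgainNorm 0 b (u (σ 2)) := by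
  obtain ⟨C, hC, h⟩ := exists_weightedL2Norm_product_le hs hb hb' hsb
  refine ⟨C, hC, fun σ u h0 h1 h2 => ENNReal.le_mul_of_forall_gt hC h0 h1 h2 fun r₀ r₁ r₂ hr₀ hr₁ hr₂ => ?_⟩
  obtain ⟨X, hX, hXm, hXr⟩ := exists_measurable_weightedL2Norm_lt hr₀
  obtain ⟨Y, hY, hYm, hYr⟩ := exists_measurable_weightedL2Norm_lt hr₁
  obtain ⟨Z, hZ, hZm, hZr⟩ := exists_measurable_weightedL2Norm_lt hr₂
  have hXE := weightedEnergy_ne_top_of_weightedL2Norm_lt hXr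
  have hYE := weightedEnergy_ne_top_of_weightedL2Norm_lt hYr
  have hZE := weightedEnergy_ne_top_of_weightedL2Norm_lt hZr
  have hb0 : 0 ≤ b := by linarith
  obtain ⟨hX2, hXw⟩ := hX.memLp_isWaveLimit hs.le hb0 hXm hXE
  obtain ⟨hY2, hYw⟩ := hY.memLp_isWaveLimit hs.le hb0 hYm hYE
  obtain ⟨hZ2, hZw⟩ := hZ.memLp_isWaveLimit le_rfl hb0 hZm hZE
  have hmeas : ∀ i, AEStronglyMeasurable (u i) := by
    intro i
    obtain ⟨j, rfl⟩ := σ.surjective i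
    fin_cases j
    exacts [hX2.1, hY2.1, hZ2.1]
  -- The modulus of the product ignores the conjugate and the order of the factors, so one estimate
  -- serves all permutations.
  have hnorm : ∀ p, ‖u 0 p * (starRingEnd ℂ) (u 1 p) * u 2 p‖ₑ =
      ‖u (σ 0) p‖ₑ * ‖u (σ 1) p‖ₑ * ‖u (σ 2) p‖ₑ := fun p => by
    have h1 := Equiv.prod_comp σ fun i => ‖u i p‖ₑ
    rw [Fin.prod_univ_three, Fin.prod_univ_three] at h1
    rw [h1, enorm_mul, enorm_mul, ← ofReal_norm ((starRingEnd ℂ) _), RCLike.norm_conj, ofReal_norm]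
  obtain ⟨hw, hle⟩ := h _ _ _ _ X Y Z
    (((hmeas 0).mul (Complex.continuous_conj.comp_aestronglyMeasurable (hmeas 1))).mul (hmeas 2))
    hnorm hX2 hY2 hZ2 hXw hYw hZw hXE hZE
  refine (iInf₂_le _ (isSpaceTimeFourier_of_integrable hw)).trans (hle.trans ?_)
  gcongr

end Trilinear

theorem lemma2p5 (s b : ℝ) (hs : 0 < s) (hb : max (1 / 4) (1 / 2 - s / 4) < b) :
    ∃ C : NNReal, ∀ (σ : Equiv.Perm (Fin 3)) (u : Fin 3 → ℝ × Torus2 → ℂ),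
      u (σ 0) ∈ BourgainSpace s b → u (σ 1) ∈ BourgainSpace s b → u (σ 2) ∈ BourgainSpace 0 b →
        (fun p => u 0 p * (starRingEnd ℂ) (u 1 p) * u 2 p) ∈ BourgainSpace 0 (-b) ∧
        bourgainNorm 0 (-b) (fun p => u 0 p * (starRingEnd ℂ) (u 1 p) * u 2 p) ≤
          C * bourgainNorm s b (u (σ 0)) * bourgainNorm s b (u (σ 1)) *
            bourgainNorm 0 b (u (σ 2)) := by
  -- Lowering `b` to some `β < 1/2` above the threshold gives a stronger estimate: the norms on the
  -- right decrease, while the `X^{0,-β}` norm on the left dominates the `X^{0,-b}` norm.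
  obtain ⟨β, hβ, hβ'⟩ : ∃ β, max (1 / 4) (1 / 2 - s / 4) < β ∧ β < min b (1 / 2) :=
    exists_between (lt_min hb (max_lt (by norm_num) (by linarith)))
  have hβb : β ≤ b := (hβ'.trans_le (min_le_left _ _)).le
  obtain ⟨C, hC, h⟩ := exists_bourgainNorm_product_le hs ((le_max_left _ _).trans_lt hβ)
    (hβ'.trans_le (min_le_right _ _)) ((le_max_right _ _).trans_lt hβ)
  refine ⟨C.toNNReal, fun σ u h0 h1 h2 => ?_⟩
  have m0 := bourgainNorm_mono_exponent s hβb (u (σ 0))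
  have m1 := bourgainNorm_mono_exponent s hβb (u (σ 1))
  have m2 := bourgainNorm_mono_exponent 0 hβb (u (σ 2))
  simp only [BourgainSpace, Set.mem_ofPred_eq] at h0 h1 h2 ⊢
  rw [ENNReal.coe_toNNReal hC]
  have key : bourgainNorm 0 (-b) (fun p => u 0 p * (starRingEnd ℂ) (u 1 p) * u 2 p) ≤
      C * bourgainNorm s b (u (σ 0)) * bourgainNorm s b (u (σ 1)) * bourgainNorm 0 b (u (σ 2)) := by
    refine (bourgainNorm_mono_exponent 0 (neg_le_neg hβb) _).trans
      ((h σ u (ne_top_of_le_ne_top h0.ne m0) (ne_top_of_le_ne_top h1.ne m1)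
        (ne_top_of_le_ne_top h2.ne m2)).trans ?_)
    gcongr
  exact ⟨key.trans_lt (ENNReal.mul_lt_top (ENNReal.mul_lt_top (ENNReal.mul_lt_top hC.lt_top h0) h1) h2),
    key⟩
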